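/- Let $\mathbb F$ be a field, $m,n\ge 0$, and let $\mathfrak g=gl(m,n)$ be the general linear Lie superalgebra over $\mathbb F$ with matrix units $e_{ij}$ ($1\le i,j\le m+n$); $e_{ij}$ is odd if exactly one of $i,j$ is $\le m$, and even otherwise. Put $$\mathcal I_0=\{(i,j): 1\le i<j\le m\ \text{or}\ m<i<j\le m+n\},\qquad \mathcal I_1=\{(i,j): 1\le i\le m<j\le m+n\},$$ $f_{ij}=e_{ji}$ for $(i,j)\in\mathcal I_0\cup\mathcal I_1$, $H=\langle e_{ii}\rangle$, $N^+=\langle e_{ij}:(i,j)\in\mathcal I_0\cup\mathcal I_1\rangle$, $N^-=\langle f_{ij}:(i,j)\in\mathcal I_0\cup\mathcal I_1\rangle$. Let $U(\cdot)$ denote the universal enveloping superalgebra (in characteristic $2$ this includes the relations that the square of an odd element $x$ in $U$ is the matrix $x^2$). Order $\mathcal I_1$ by $(i,j)\prec(s,t)$ iff $j>t$, or $j=t$ and $i<s$. Let $f_{\mathcal I_1}\in U(\mathfrak g)$ be the product of all $f_{ij}$, $(i,j)\in\mathcal I_1$, in this order, and $e_{\mathcal I_1}$ the product of all $e_{ij}$,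 $(i,j)\in\mathcal I_1$, in the reversed order. Write $e_{\mathcal I_1}f_{\mathcal I_1}$ in the triangular decomposition $U(\mathfrak g)\cong U(N^-)\otimes U(H)\otimes U(N^+)$, and let $f(h)\in U(H)$ be its $U(H)$-component, that is, its image under $\varepsilon\otimes\mathrm{id}\otimes\varepsilon$, where $\varepsilon$ is the counit; it exists and does not depend on the chosen expression. For $\lambda\in H^*$ let $f(h)(\lambda)$ be the image of $f(h)$ under the algebra homomorphism $U(H)\to\mathbb F$ extending $\lambda$. Let $\epsilon_i\in H^*$ be dual to $e_{ii}$, with the symmetric bilinear form on $H^*$ given by $(\epsilon_i,\epsilon_j)=\delta_{ij}$ if $i\le m$ and $-\delta_{ij}$ if $i>m$. Put $\Phi_k^+=\{\epsilon_i-\epsilon_j:(i,j)\in\mathcal I_k\}$, $\rho_k=\frac12\sum_{\alpha\in\Phi_k^+}\alpha$ for $k=0,1$, and $\rho=\rho_0-\rho_1$. Then for every $\lambda\in H^*$ $$f(h)(\lambda)=f_{m,n}(\lambda)=\prod_{\alpha\in\Phi_1^+}(\lambda+\rho,\alpha).$$ Here, if $\operatorname{char}\mathbb F=2$, $(\lambda+\rho,\alpha)$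 is read as $(\lambda,\alpha)+(\rho,\alpha)$, where $(\rho,\alpha)$ is computed over $\mathbb Q$; it is an integer for every $\alpha\in\Phi_1^+$, and this reading agrees with the literal one if $\operatorname{char}\mathbb F\ne2$. -/

import Mathlib

open scoped TensorProduct

namespace GlSuper

/-- The index set `{1, …, m + n}`: `inl i` is the index `i ≤ m`, `inr j` is the index `m + j`. -/
abbrev Idx (m n : ℕ) : Type := Fin m ⊕ Fin n

/-- The underlying vector space of `gl(m,n)`. -/
abbrev Gl (m n : ℕ) (F : Type*) : Type _ := Matrix (Idx m n) (Idx m n) F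

/-- The parity of an index; the matrix unit `e_ij` has parity `par i + par j`. -/
def par {m n : ℕ} : Idx m n → ZMod 2 := Sum.elim (fun _ => 0) (fun _ => 1)

/-- The matrix `x` is homogeneous of degree `a`. -/
def IsHomog {m n : ℕ} {F : Type*} [Field F] (a : ZMod 2) (x : Gl m n F) : Prop :=
  ∀ i j, x i j ≠ 0 → par i + par j = a

/-- The homogeneous component of degree `a` of the matrix `x`. -/
def homogPart {m n : ℕ} {F : Type*} [Field F] (a : ZMod 2) (x : Gl m n F) : Gl m n F :=
  Matrix.of fun i j => if par i + par j = a then x i j else 0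

/-- The sign `(-1)^(ab)`. -/
def sgn (F : Type*) [Field F] (a b : ZMod 2) : F := (-1) ^ (a.val * b.val)

/-- The Lie superbracket `xy - (-1)^(ab) yx` of matrices `x`, `y` homogeneous of degrees
`a`, `b`. -/
def sbracket {m n : ℕ} {F : Type*} [Field F] (a b : ZMod 2) (x y : Gl m n F) : Gl m n F :=
  x * y - sgn F a b • (y * x)

/-- A Lie sub-superalgebra of `gl(m,n)`: a graded subspace closed under the superbracket and
under the squaring `x ↦ x²` of odd elements. (If `2 ≠ 0` in `F`, the last condition follows from
the others, because `[x, x] = 2x²`; in characteristic 2 the squaring is part of the structure of a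
Lie superalgebra.) -/
structure SubSuper (m n : ℕ) (F : Type*) [Field F] where
  carrier : Submodule F (Gl m n F)
  graded : ∀ a, ∀ x ∈ carrier, homogPart a x ∈ carrier
  bracket_mem : ∀ a b, ∀ x ∈ carrier, ∀ y ∈ carrier, IsHomog a x → IsHomog b y →
    sbracket a b x y ∈ carrier
  sq_mem : ∀ x ∈ carrier, IsHomog 1 x → x * x ∈ carrier

/-- For a transitive relation `P`, the sub-superalgebra spanned by the `e_ij` with `P i j`, that
is, the matrices whose nonzero entries all sit at places `(i, j)` with `P i j`. -/
def ofPattern {m n : ℕ} (F : Type*) [Field F] (P : Idx m n → Idx m n → Prop)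
    (hP : ∀ i j k, P i j → P j k → P i k) : SubSuper m n F :=
  have key : ∀ x y : Gl m n F, (∀ i j, x i j ≠ 0 → P i j) → (∀ i j, y i j ≠ 0 → P i j) →
      ∀ i j, (x * y) i j ≠ 0 → P i j := by
    intro x y hx hy i j h
    rw [Matrix.mul_apply] at h
    obtain ⟨k, -, hk⟩ := Finset.exists_ne_zero_of_sum_ne_zero h
    exact hP i k j (hx i k (left_ne_zero_of_mul hk)) (hy k j (right_ne_zero_of_mul hk))
  { carrier :=
      { carrier := {x | ∀ i j, x i j ≠ 0 → P i j}
        zero_mem' := fun i j h => absurd rfl h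
        add_mem' := by
          intro x y hx hy i j h
          by_cases hxi : x i j = 0
          · exact hy i j fun hyi => h (by simp [hxi, hyi])
          · exact hx i j hxi
        smul_mem' := by
          intro c x hx i j h
          exact hx i j fun h0 => h (by simp [h0]) }
    graded := by
      intro a x hx i j h
      refine hx i j fun h0 => h ?_
      simp [homogPart, h0]
    bracket_mem := by
      intro a b x hx y hy _ _ i j h
      by_cases h1 : (x * y) i j = 0
      · exact key y x hy hx i j fun h2 => h (by simp [sbracket, h1, h2])
      · exact key x y hx hy i j h1
    sq_mem := fun x hx _ => key x x hx hx }

/-- `(i, j) ∈ I₀`: both indices on the same side, and `i < j`. -/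
def InI0 {m n : ℕ} : Idx m n → Idx m n → Prop
  | Sum.inl i, Sum.inl j => i < j
  | Sum.inr i, Sum.inr j => i < j
  | _, _ => False

/-- `(i, j) ∈ I₁`: `i ≤ m < j`. -/
def InI1 {m n : ℕ} : Idx m n → Idx m n → Prop
  | Sum.inl _, Sum.inr _ => True
  | _, _ => False

/-- `(i, j) ∈ I = I₀ ∪ I₁`. -/
def InI {m n : ℕ} (i j : Idx m n) : Prop := InI0 i j ∨ InI1 i j

theorem InI.trans {m n : ℕ} (i j k : Idx m n) (h : InI i j) (h' : InI j k) : InI i k := by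
  rcases i with i | i <;> rcases j with j | j <;> rcases k with k | k <;>
    simp_all [InI, InI0, InI1] <;> exact lt_trans h h'

/-- The whole Lie superalgebra `𝔤 = gl(m,n)`. -/
def g (m n : ℕ) (F : Type*) [Field F] : SubSuper m n F :=
  ofPattern F (fun _ _ => True) (fun _ _ _ _ _ => trivial)

/-- The diagonal matrices `H`. -/
def H (m n : ℕ) (F : Type*) [Field F] : SubSuper m n F :=
  ofPattern F (fun i j => i = j) (fun _ _ _ => Eq.trans)

/-- `N⁺`, spanned by the `e_ij` with `(i, j) ∈ I`. -/
def Npos (m n : ℕ) (F : Type*) [Field F] : SubSuper m n F :=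
  ofPattern F InI InI.trans

/-- `N⁻`, spanned by the `f_ij = e_ji` with `(i, j) ∈ I`. -/
def Nneg (m n : ℕ) (F : Type*) [Field F] : SubSuper m n F :=
  ofPattern F (fun i j => InI j i) (fun i j k h h' => InI.trans k j i h' h)

/-- The defining relations of the universal enveloping superalgebra. The relations `sq` are
consequences of the relations `bracket` if `2 ≠ 0` in `F`; in characteristic 2 they belong to the
definition. -/
inductive EnvRel {m n : ℕ} {F : Type*} [Field F] (V : SubSuper m n F) :
    TensorAlgebra F V.carrier → TensorAlgebra F V.carrier → Prop
  | bracket (a b : ZMod 2) (x y z : V.carrier) (hx : IsHomog a (x : Gl m n F))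
      (hy : IsHomog b (y : Gl m n F)) (hz : (z : Gl m n F) = sbracket a b (x : Gl m n F) y) :
      EnvRel V (TensorAlgebra.ι F x * TensorAlgebra.ι F y
        - sgn F a b • (TensorAlgebra.ι F y * TensorAlgebra.ι F x)) (TensorAlgebra.ι F z)
  | sq (x z : V.carrier) (hx : IsHomog 1 (x : Gl m n F))
      (hz : (z : Gl m n F) = (x : Gl m n F) * x) :
      EnvRel V (TensorAlgebra.ι F x * TensorAlgebra.ι F x) (TensorAlgebra.ι F z)

/-- The universal enveloping superalgebra `U(V)`. -/
def U {m n : ℕ} {F : Type*} [Field F] (V : SubSuper m n F) : Type _ := RingQuot (EnvRel V)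

noncomputable instance instRingU {m n : ℕ} {F : Type*} [Field F] (V : SubSuper m n F) :
    Ring (U V) :=
  inferInstanceAs (Ring (RingQuot (EnvRel V)))

noncomputable instance instAlgebraU {m n : ℕ} {F : Type*} [Field F] (V : SubSuper m n F) :
    Algebra F (U V) :=
  inferInstanceAs (Algebra F (RingQuot (EnvRel V)))

/-- The quotient map from the tensor algebra. -/
noncomputable def mkU {m n : ℕ} {F : Type*} [Field F] (V : SubSuper m n F) :
    TensorAlgebra F V.carrier →ₐ[F] U V :=
  RingQuot.mkAlgHom F (EnvRel V)

theorem mkU_rel {m n : ℕ} {F : Type*} [Field F] (V : SubSuper m n F)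
    {s t : TensorAlgebra F V.carrier} (h : EnvRel V s t) : mkU V s = mkU V t :=
  RingQuot.mkAlgHom_rel F h

/-- The canonical map `V → U(V)`. -/
noncomputable def ι {m n : ℕ} {F : Type*} [Field F] (V : SubSuper m n F) :
    V.carrier →ₗ[F] U V :=
  (mkU V).toLinearMap ∘ₗ TensorAlgebra.ι F

theorem ι_bracket {m n : ℕ} {F : Type*} [Field F] (V : SubSuper m n F) (a b : ZMod 2)
    (x y z : V.carrier) (hx : IsHomog a (x : Gl m n F)) (hy : IsHomog b (y : Gl m n F))
    (hz : (z : Gl m n F) = sbracket a b (x : Gl m n F) y) :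
    ι V x * ι V y - sgn F a b • (ι V y * ι V x) = ι V z := by
  have := mkU_rel V (EnvRel.bracket a b x y z hx hy hz)
  simpa [ι] using this

theorem ι_sq {m n : ℕ} {F : Type*} [Field F] (V : SubSuper m n F)
    (x z : V.carrier) (hx : IsHomog 1 (x : Gl m n F))
    (hz : (z : Gl m n F) = (x : Gl m n F) * x) : ι V x * ι V x = ι V z := by
  have := mkU_rel V (EnvRel.sq x z hx hz)
  simpa [ι] using this

/-- The universal property of `U(V)`. -/
noncomputable def lift {m n : ℕ} {F : Type*} [Field F] (V : SubSuper m n F) {A : Type*} [Ring A]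
    [Algebra F A] (φ : V.carrier →ₗ[F] A)
    (hb : ∀ (a b : ZMod 2) (x y z : V.carrier), IsHomog a (x : Gl m n F) →
      IsHomog b (y : Gl m n F) → (z : Gl m n F) = sbracket a b (x : Gl m n F) y →
      φ x * φ y - sgn F a b • (φ y * φ x) = φ z)
    (hs : ∀ x z : V.carrier, IsHomog 1 (x : Gl m n F) →
      (z : Gl m n F) = (x : Gl m n F) * x → φ x * φ x = φ z) : U V →ₐ[F] A :=
  RingQuot.liftAlgHom F ⟨TensorAlgebra.lift F φ, by
    intro s t h
    cases h with
    | bracket a b x y z hx hy hz => simpa using hb a b x y z hx hy hz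
    | sq x z hx hz => simpa using hs x z hx hz⟩

theorem lift_ι {m n : ℕ} {F : Type*} [Field F] (V : SubSuper m n F) {A : Type*} [Ring A]
    [Algebra F A] (φ : V.carrier →ₗ[F] A) (hb) (hs) (x : V.carrier) :
    lift V φ hb hs (ι V x) = φ x := by
  have h := RingQuot.liftAlgHom_mkAlgHom_apply F (TensorAlgebra.lift F φ) (s := EnvRel V)
    (by
      intro s t h
      cases h with
      | bracket a b x y z hx hy hz => simpa using hb a b x y z hx hy hz
      | sq x z hx hz => simpa using hs x z hx hz) (TensorAlgebra.ι F x)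
  rw [TensorAlgebra.lift_ι_apply] at h
  exact h

theorem mem_g {m n : ℕ} {F : Type*} [Field F] (x : Gl m n F) : x ∈ (g m n F).carrier :=
  fun _ _ _ => trivial

/-- The map `U(V) → U(𝔤)` induced by the inclusion `V ⊆ 𝔤`. -/
noncomputable def toUg {m n : ℕ} {F : Type*} [Field F] (V : SubSuper m n F) :
    U V →ₐ[F] U (g m n F) :=
  lift V (ι (g m n F) ∘ₗ Submodule.inclusion (fun x _ => mem_g x))
    (fun a b _ _ _ hx hy hz => ι_bracket (g m n F) a b _ _ _ hx hy hz)
    (fun _ _ hx hz => ι_sq (g m n F) _ _ hx hz)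

/-- The counit (augmentation) `U(V) → F`, which sends `V` to `0`. -/
noncomputable def counit {m n : ℕ} {F : Type*} [Field F] (V : SubSuper m n F) : U V →ₐ[F] F :=
  lift V 0 (by simp) (by simp)

/-- The multiplication map `U(N⁻) ⊗ U(H) ⊗ U(N⁺) → U(𝔤)` of the triangular decomposition. -/
noncomputable def triMul (m n : ℕ) (F : Type*) [Field F] :
    (U (Nneg m n F) ⊗[F] U (H m n F)) ⊗[F] U (Npos m n F) →ₗ[F] U (g m n F) :=
  LinearMap.mul' F _ ∘ₗ TensorProduct.map
    (LinearMap.mul' F _ ∘ₗ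
      TensorProduct.map (toUg (Nneg m n F)).toLinearMap (toUg (H m n F)).toLinearMap)
    (toUg (Npos m n F)).toLinearMap

/-- The `U(H)`-component `u⁻ ⊗ u⁰ ⊗ u⁺ ↦ ε(u⁻) ε(u⁺) u⁰`, that is, the projection to
`F ⊗ U(H) ⊗ F = U(H)` whose kernel is spanned by the `u⁻ ⊗ u⁰ ⊗ u⁺` with
`u⁻ ∈ N⁻ U(N⁻)` or `u⁺ ∈ U(N⁺) N⁺`. -/
noncomputable def hComp (m n : ℕ) (F : Type*) [Field F] :
    (U (Nneg m n F) ⊗[F] U (H m n F)) ⊗[F] U (Npos m n F) →ₗ[F] U (H m n F) :=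
  (TensorProduct.rid F _).toLinearMap ∘ₗ TensorProduct.map
    ((TensorProduct.lid F _).toLinearMap ∘ₗ
      TensorProduct.map (counit (Nneg m n F)).toLinearMap LinearMap.id)
    (counit (Npos m n F)).toLinearMap

/-- The image in `U(𝔤)` of the matrix unit `e_ij`. -/
noncomputable def E {m n : ℕ} {F : Type*} [Field F] (i j : Idx m n) : U (g m n F) :=
  ι (g m n F) ⟨Matrix.single i j 1, mem_g _⟩

/-- The elements of `I₁` in the order `≺`, where `(i, j) ≺ (s, t)` iff `j > t`, or `j = t` and
`i < s`; the pair `(i, j)` stands for `(i, m + j)`. -/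
def I1List (m n : ℕ) : List (Fin m × Fin n) :=
  (List.finRange n).reverse.flatMap fun j => (List.finRange m).map fun i => (i, j)

theorem mem_I1List {m n : ℕ} (p : Fin m × Fin n) : p ∈ I1List m n := by
  simp [I1List, Prod.ext_iff]

theorem I1List_pairwise (m n : ℕ) :
    (I1List m n).Pairwise fun p q => q.2 < p.2 ∨ p.2 = q.2 ∧ p.1 < q.1 := by
  rw [I1List, List.pairwise_flatMap]
  constructor
  · intro j _
    rw [List.pairwise_map]
    exact (List.pairwise_lt_finRange m).imp fun h => Or.inr ⟨rfl, h⟩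
  · rw [List.pairwise_reverse]
    refine (List.pairwise_lt_finRange n).imp ?_
    intro a b h x hx y hy
    simp only [List.mem_map] at hx hy
    obtain ⟨_, _, rfl⟩ := hx
    obtain ⟨_, _, rfl⟩ := hy
    exact Or.inl h

/-- `f_{I₁}`: the product of the `f_ij = e_ji` in the order `≺`. -/
noncomputable def fI1 (m n : ℕ) (F : Type*) [Field F] : U (g m n F) :=
  ((I1List m n).map fun p => E (Sum.inr p.2) (Sum.inl p.1)).prod

/-- `e_{I₁}`: the product of the `e_ij` in the reversed order. -/
noncomputable def eI1 (m n : ℕ) (F : Type*) [Field F] : U (g m n F) :=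
  ((I1List m n).reverse.map fun p => E (Sum.inl p.1) (Sum.inr p.2)).prod

/-- The dual space `H*`. -/
abbrev Hdual (m n : ℕ) (F : Type*) [Field F] : Type _ := Module.Dual F (H m n F).carrier

/-- The value at `lam ∈ H*` of an element of `U(H) = S(H)`, a polynomial function on `H*`: the
algebra homomorphism `U(H) → F` which extends `lam : H → F`. -/
noncomputable def evalAt {m n : ℕ} {F : Type*} [Field F] (lam : Hdual m n F) :
    U (H m n F) →ₐ[F] F :=
  have odd : ∀ x : (H m n F).carrier, IsHomog 1 (x : Gl m n F) → x = 0 := by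
    intro x hx
    ext i j
    by_contra h
    have h1 : i = j := x.2 i j h
    have h2 := hx i j h
    subst h1
    rcases i with i | i <;> revert h2 <;> simp only [par, Sum.elim_inl, Sum.elim_inr] <;> decide
  have comm : ∀ x y : (H m n F).carrier, (x : Gl m n F) * y = (y : Gl m n F) * x := by
    intro x y
    have hd : ∀ z : (H m n F).carrier, (z : Gl m n F) = Matrix.diagonal fun i => z.1 i i := by
      intro z
      ext i j
      by_cases h : i = j
      · subst h; simp
      · rw [Matrix.diagonal_apply_ne _ h]
        by_contra h0
        exact h (z.2 i j h0)
    rw [hd x, hd y, Matrix.diagonal_mul_diagonal, Matrix.diagonal_mul_diagonal]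
    simp only [mul_comm]
  lift (H m n F) lam
    (by
      intro a b x y z hx hy hz
      have hab : ∀ a b : ZMod 2, (a = 1 ∧ b = 1) ∨ a.val * b.val = 0 := by decide
      rcases hab a b with ⟨rfl, rfl⟩ | h
      · have hz0 : z = 0 := by
          apply Subtype.ext
          rw [hz, odd x hx, odd y hy]
          simp [sbracket]
        rw [odd x hx, hz0]
        simp
      · have hz0 : z = 0 := by
          apply Subtype.ext
          rw [hz, sbracket, comm x y]
          simp [sgn, h]
        rw [hz0]
        simp [sgn, h, mul_comm])
    (by
      intro x z hx hz
      have hz0 : z = 0 := by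
        apply Subtype.ext
        rw [hz, odd x hx]
        simp
      rw [hz0, odd x hx]
      simp)

/-- `e_ii` as an element of `H`. -/
def hBasis {m n : ℕ} {F : Type*} [Field F] (i : Idx m n) : (H m n F).carrier :=
  ⟨Matrix.single i i 1, fun a b h => by
    by_contra hab
    refine h (Matrix.single_apply_of_ne _ _ _ _ _ ?_)
    rintro ⟨rfl, rfl⟩
    exact hab rfl⟩

/-- The weight `ε_i ∈ H*`, which reads off the `i`-th diagonal entry. -/
def eps {m n : ℕ} (F : Type*) [Field F] (i : Idx m n) : Hdual m n F where
  toFun x := x.1 i i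
  map_add' _ _ := rfl
  map_smul' _ _ := rfl

theorem eps_apply {m n : ℕ} (F : Type*) [Field F] (i : Idx m n) (x : (H m n F).carrier) :
    eps F i x = x.1 i i := rfl

/-- The symmetric bilinear form on `H*` with `(ε_i, ε_j) = δ_ij` if `i ≤ m` and `-δ_ij` if
`i > m`; the coefficient of `ε_i` in `lam ∈ H*` is `lam (e_ii)`. -/
def form {m n : ℕ} {F : Type*} [Field F] (lam mu : Hdual m n F) : F :=
  (∑ i : Fin m, lam (hBasis (Sum.inl i)) * mu (hBasis (Sum.inl i)))
    - ∑ j : Fin n, lam (hBasis (Sum.inr j)) * mu (hBasis (Sum.inr j))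

/-- The root `ε_i - ε_j`. -/
def root {m n : ℕ} (F : Type*) [Field F] (i j : Idx m n) : Hdual m n F := eps F i - eps F j

open Classical in
/-- `ρ₀`, half the sum of the positive even roots. -/
noncomputable def rho0 (m n : ℕ) (F : Type*) [Field F] : Hdual m n F :=
  (1 / 2 : F) • ∑ p : Idx m n × Idx m n with InI0 p.1 p.2, root F p.1 p.2

open Classical in
/-- `ρ₁`, half the sum of the positive odd roots. -/
noncomputable def rho1 (m n : ℕ) (F : Type*) [Field F] : Hdual m n F :=
  (1 / 2 : F) • ∑ p : Idx m n × Idx m n with InI1 p.1 p.2, root F p.1 p.2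

/-- `ρ = ρ₀ - ρ₁`. -/
noncomputable def rho (m n : ℕ) (F : Type*) [Field F] : Hdual m n F := rho0 m n F - rho1 m n F

end GlSuper

/-! That a component exists is the spanning half of the triangular decomposition
(`triMul_surjective`). That it is unique needs no PBW theorem. It suffices to have, over the
commutative ring `U(H)`, one `gl(m,n)`-module with a vector `v` that `N⁺` kills and on which each
`e_ii` acts as the scalar `e_ii ∈ U(H)`, and a functional `φ` that kills the image of `N⁻` and
satisfies `φ v = 1`. Then `φ (u⁻ u⁰ u⁺ v) = ε(u⁻) ε(u⁺) u⁰`, so the component of `u` is `φ (u v)`,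
which depends on `u` alone (`exists_projection`).

The module comes by induction on the size (`exists_highest_weight`). If `gl(k)` acts on `M` by
operators `r_ij`, then `gl(k+1)` acts on `M[x_1, …, x_k]`, with even and odd variables, through
`∂_j`, `L_ij = x_i ∂_j + r_ij`, `z - ∑ x_k ∂_k` and `x_j z - ∑ ± x_k L_jk`, where `z` is a scalar.
These are the differential operators on the big cell. Their coefficients are integers, so the
construction works in every characteristic; in characteristic 2 the squares of odd elements need
arguments of their own. The constant `v` stays a highest weight vector, and evaluation at zero
followed by the old functional is the new one.

For the value, let `w` be the result of applying the `f_p` to `v` over a final segment of `I₁`. By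
odd reflections, `e_p` kills `w` for every `p` outside the segment
(`IsHighestWeight.odd_reflection`). If `p = (i, j)` is the root just before the segment, then `e_p
f_p w = (e_ii + e_jj) w`, a multiple of `w`. Hence `e_{I₁} f_{I₁}` cancels from the inside, one
scalar factor per odd root. Counting the roots of the segment in the row and the column of `p` shows
that the scalar exceeds `h_i + h_j` by `m - 1 - i - j`, with indices counted from zero on each side
(`IsFinal.shift_eq`). This is `(ρ, ε_i - ε_j)` (`form_rho_root`). -/

namespace GlSuper

/-! ### Koszul signs -/

/-- The Koszul sign `(-1)^(ab)` as an integer. -/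
def ksgn (a b : ZMod 2) : ℤ := (-1) ^ (a.val * b.val)

theorem ksgn_comm (a b : ZMod 2) : ksgn a b = ksgn b a := by decide +revert

theorem ksgn_add_left (a b c : ZMod 2) : ksgn (a + b) c = ksgn a c * ksgn b c := by
  decide +revert

theorem ksgn_add_right (a b c : ZMod 2) : ksgn a (b + c) = ksgn a b * ksgn a c := by
  decide +revert

theorem ksgn_mul_self (a b : ZMod 2) : ksgn a b * ksgn a b = 1 := by decide +revert

@[simp] theorem ksgn_zero_left (a : ZMod 2) : ksgn 0 a = 1 := by decide +revert

@[simp] theorem ksgn_zero_right (a : ZMod 2) : ksgn a 0 = 1 := by decide +revert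

@[simp] theorem ksgn_one_one : ksgn 1 1 = -1 := by decide

/-! ### Calculus of signed commutators -/

section SignedCommutator

variable {A : Type*} [Ring A]

/-- The signed commutator `xy - c yx`. -/
def sc (c : ℤ) (x y : A) : A := x * y - c • (y * x)

theorem sc_add_right (c : ℤ) (x y z : A) : sc c x (y + z) = sc c x y + sc c x z := by
  simp only [sc, mul_add, add_mul]; module

theorem sc_add_left (c : ℤ) (x y z : A) : sc c (x + y) z = sc c x z + sc c y z := by
  simp only [sc, mul_add, add_mul]; module

theorem sc_sub_right (c : ℤ) (x y z : A) : sc c x (y - z) = sc c x y - sc c x z := by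
  simp only [sc, mul_sub, sub_mul]; module

theorem sc_sub_left (c : ℤ) (x y z : A) : sc c (x - y) z = sc c x z - sc c y z := by
  simp only [sc, mul_sub, sub_mul]; module

theorem sc_smul_right (c d : ℤ) (x y : A) : sc c x (d • y) = d • sc c x y := by
  simp only [sc, mul_smul_comm, smul_mul_assoc]; module

theorem sc_smul_left (c d : ℤ) (x y : A) : sc c (d • x) y = d • sc c x y := by
  simp only [sc, mul_smul_comm, smul_mul_assoc]; module

theorem sc_sum_right {I : Type*} (s : Finset I) (c : ℤ) (x : A) (y : I → A) :
    sc c x (∑ i ∈ s, y i) = ∑ i ∈ s, sc c x (y i) := by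
  simp only [sc, Finset.mul_sum, Finset.sum_mul, Finset.smul_sum, Finset.sum_sub_distrib]

theorem sc_sum_left {I : Type*} (s : Finset I) (c : ℤ) (x : I → A) (y : A) :
    sc c (∑ i ∈ s, x i) y = ∑ i ∈ s, sc c (x i) y := by
  simp only [sc, Finset.mul_sum, Finset.sum_mul, Finset.smul_sum, Finset.sum_sub_distrib]

/-- The super Leibniz rule: `c` and `d` are the signs for passing `x` through `y` and through `z`.
With its mirror image `sc_mul_left` it reduces the brackets of products below to brackets of
factors. -/
theorem sc_mul_right (c d : ℤ) (x y z : A) :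
    sc (c * d) x (y * z) = sc c x y * z + c • (y * sc d x z) := by
  simp only [sc, mul_sub, sub_mul, mul_smul_comm, smul_mul_assoc, mul_assoc]; module

theorem sc_mul_left (c d : ℤ) (x y z : A) :
    sc (c * d) (x * y) z = x * sc d y z + d • (sc c x z * y) := by
  simp only [sc, mul_sub, sub_mul, mul_smul_comm, smul_mul_assoc, mul_assoc]; module

theorem sc_swap {c : ℤ} (hc : c * c = 1) (x y : A) : sc c y x = -c • sc c x y := by
  have : (c * c) • (y * x) = y * x := by rw [hc, one_smul]
  simp only [sc, smul_sub, smul_smul, neg_mul, neg_smul, this]; abel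

theorem sc_eq_zero_swap {c : ℤ} (hc : c * c = 1) {x y : A} (h : sc c x y = 0) : sc c y x = 0 := by
  rw [sc_swap hc, h, smul_zero]

theorem mul_eq_of_sc {c : ℤ} {x y z : A} (h : sc c x y = z) : x * y = c • (y * x) + z := by
  rw [← h, sc]; abel

theorem sc_one_eq_zero {x y : A} (h : Commute x y) : sc 1 x y = 0 := by
  rw [sc, one_smul, h.eq, sub_self]

end SignedCommutator

/-! ### Relations of the super Weyl algebra and of `gl` -/

section Relations

variable {A : Type*} [Ring A] {I : Type*} [DecidableEq I]

/-- The defining relations of the super Weyl algebra: the variables `X i` and the derivations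
`D i` have parity `q i`. -/
structure IsOsc (q : I → ZMod 2) (X D : I → A) : Prop where
  XX : ∀ i j, sc (ksgn (q i) (q j)) (X i) (X j) = 0
  DD : ∀ i j, sc (ksgn (q i) (q j)) (D i) (D j) = 0
  DX : ∀ i j, sc (ksgn (q i) (q j)) (D i) (X j) = if i = j then 1 else 0
  X_sq : ∀ i, q i = 1 → X i * X i = 0
  D_sq : ∀ i, q i = 1 → D i * D i = 0

/-- The relations of the matrix units in the enveloping superalgebra of the general linear Lie
superalgebra with parities `q`. -/
structure IsGl (q : I → ZMod 2) (e : I → I → A) : Prop where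
  bracket : ∀ i j k l, sc (ksgn (q i + q j) (q k + q l)) (e i j) (e k l) =
    (if j = k then e i l else 0) - ksgn (q i + q j) (q k + q l) • (if i = l then e k j else 0)
  sq : ∀ i j, q i + q j = 1 → e i j * e i j = 0

/-- The relations involve only sums of two parities, so all parities may be shifted by a common
constant. -/
theorem IsGl.congr {q q' : I → ZMod 2} {e : I → I → A} (h : IsGl q e)
    (hq : ∀ i j, q i + q j = q' i + q' j) : IsGl q' e where
  bracket i j k l := by simpa only [hq] using h.bracket i j k l
  sq i j hij := h.sq i j (by rw [hq, hij])

theorem IsGl.comp {J : Type*} [DecidableEq J] {q : I → ZMod 2} {e : I → I → A} (h : IsGl q e)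
    {σ : J → I} (hσ : Function.Injective σ) :
    IsGl (fun i => q (σ i)) (fun i j => e (σ i) (σ j)) where
  bracket i j k l := by simpa only [hσ.eq_iff] using h.bracket (σ i) (σ j) (σ k) (σ l)
  sq i j hij := h.sq _ _ hij

/-- The bracket relation is symmetric in the two matrix units. -/
theorem bracket_swap {c : ℤ} (hc : c * c = 1) {x y a b : A} (h : sc c x y = a - c • b) :
    sc c y x = b - c • a := by
  rw [sc_swap hc, h, smul_sub, smul_smul, neg_mul, hc]; module

end Relations

/-! ### Brackets of the differential operators on the big cell -/

section Induction

variable {A : Type*} [Ring A] {I : Type*} [DecidableEq I]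

/-- A `gl`-family of operators together with oscillators that supercommute with it. -/
structure IsGlOsc (q : I → ZMod 2) (X D : I → A) (r : I → I → A) (z : A) : Prop where
  osc : IsOsc q X D
  gl : IsGl q r
  rX : ∀ i j k, sc (ksgn (q i + q j) (q k)) (r i j) (X k) = 0
  rD : ∀ i j k, sc (ksgn (q i + q j) (q k)) (r i j) (D k) = 0
  zX : ∀ i, Commute z (X i)
  zD : ∀ i, Commute z (D i)
  zr : ∀ i j, Commute z (r i j)

/-- The operators `x_i ∂_j + r_ij`. -/
def opL (X D : I → A) (r : I → I → A) (i j : I) : A := X i * D j + r i j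

variable {q : I → ZMod 2} {X D : I → A} {r : I → I → A} {z : A}

namespace IsGlOsc

theorem sc_X_D (h : IsGlOsc q X D r z) (i j : I) :
    sc (ksgn (q i) (q j)) (X i) (D j) = -ksgn (q i) (q j) • if j = i then 1 else 0 := by
  rw [sc_swap (ksgn_mul_self _ _), ksgn_comm, h.osc.DX]

theorem sc_L_X (h : IsGlOsc q X D r z) (i j k : I) :
    sc (ksgn (q i + q j) (q k)) (opL X D r i j) (X k) = if j = k then X i else 0 := by
  rw [opL, sc_add_left, h.rX, add_zero, ksgn_add_left, sc_mul_left, h.osc.DX, h.osc.XX]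
  split_ifs <;> simp

theorem sc_L_D (h : IsGlOsc q X D r z) (i j k : I) :
    sc (ksgn (q i + q j) (q k)) (opL X D r i j) (D k) =
      -ksgn (q i + q j) (q k) • if i = k then D j else 0 := by
  rw [opL, sc_add_left, h.rD, add_zero, ksgn_add_left, sc_mul_left, h.osc.DD, h.sc_X_D]
  by_cases hik : i = k
  · subst hik
    simp only [smul_mul_assoc, one_mul, if_true, smul_smul, zero_add, mul_zero, mul_neg,
      mul_comm]
  · simp [hik, Ne.symm hik]

theorem sc_L_r (h : IsGlOsc q X D r z) (i j k l : I) :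
    sc (ksgn (q i + q j) (q k + q l)) (r i j) (opL X D r k l) =
      (if j = k then r i l else 0) - ksgn (q i + q j) (q k + q l) • (if i = l then r k j else 0) := by
  rw [opL, sc_add_right, h.gl.bracket, ksgn_add_right, sc_mul_right, h.rX, h.rD]
  simp

theorem sc_L_L (h : IsGlOsc q X D r z) (i j k l : I) :
    sc (ksgn (q i + q j) (q k + q l)) (opL X D r i j) (opL X D r k l) =
      (if j = k then opL X D r i l else 0)
        - ksgn (q i + q j) (q k + q l) • (if i = l then opL X D r k j else 0) := by
  have h1 : sc (ksgn (q i + q j) (q k + q l)) (opL X D r i j) (r k l) =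
      (if j = k then r i l else 0)
        - ksgn (q i + q j) (q k + q l) • (if i = l then r k j else 0) := by
    rw [ksgn_comm]
    refine bracket_swap (ksgn_mul_self _ _) ?_
    exact h.sc_L_r k l i j |>.trans (by simp only [eq_comm])
  rw [opL.eq_def X D r k l, sc_add_right, h1, ksgn_add_right, sc_mul_right, h.sc_L_X, h.sc_L_D]
  have h2 : ksgn (q i + q j) (q k) • (X k * (-ksgn (q i + q j) (q l) • if i = l then D j else 0)) =
      -(ksgn (q i + q j) (q k) * ksgn (q i + q j) (q l)) • if i = l then X k * D j else 0 := by
    rw [mul_smul_comm, smul_smul, mul_neg, mul_ite, mul_zero]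
  rw [h2, ite_mul, zero_mul]
  simp only [opL]
  split_ifs <;> simp <;> module

/-- One of `x_i`, `∂_j` is odd and squares to zero, which kills the square of `x_i ∂_j`. The cross
terms cancel because `x_i ∂_j` and `r_ij` are odd and anticommute. No division by 2 occurs. -/
theorem L_sq (h : IsGlOsc q X D r z) (i j : I) (hij : q i + q j = 1) :
    opL X D r i j * opL X D r i j = 0 := by
  have hne : i ≠ j := by
    rintro rfl
    exact absurd hij (by generalize q i = a; revert a; decide)
  have h1 : X i * D j * (X i * D j) = 0 := by
    have hc : D j * X i = ksgn (q j) (q i) • (X i * D j) := by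
      rw [mul_eq_of_sc (h.osc.DX j i), if_neg hne.symm, add_zero]
    have : X i * D j * (X i * D j) = ksgn (q j) (q i) • ((X i * X i) * (D j * D j)) := by
      rw [mul_assoc, ← mul_assoc (D j), hc]
      simp only [smul_mul_assoc, mul_smul_comm, mul_assoc]
    rw [this]
    have hd : q i = 1 ∨ q j = 1 := by
      revert hij; generalize q i = a; generalize q j = b; revert a b; decide
    rcases hd with hd | hd
    · rw [h.osc.X_sq i hd, zero_mul, smul_zero]
    · rw [h.osc.D_sq j hd, mul_zero, smul_zero]
  have h2 : r i j * (X i * D j) = - (X i * D j * r i j) := by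
    have := sc_mul_right (ksgn (q i + q j) (q i)) (ksgn (q i + q j) (q j)) (r i j) (X i) (D j)
    rw [h.rX, h.rD, ← ksgn_add_right, hij, ksgn_one_one] at this
    simp [sc] at this
    exact eq_neg_of_add_eq_zero_left this
  rw [opL, add_mul, mul_add, mul_add, h1, h2, h.gl.sq i j hij]
  simp

theorem commute_z_L (h : IsGlOsc q X D r z) (i j : I) : Commute z (opL X D r i j) :=
  ((h.zX i).mul_right (h.zD j)).add_right (h.zr i j)

theorem sc_X_L (h : IsGlOsc q X D r z) (i j k : I) :
    sc (ksgn (q i) (q j + q k)) (X i) (opL X D r j k) =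
      -ksgn (q i) (q j + q k) • if k = i then X j else 0 := by
  rw [ksgn_comm, sc_swap (ksgn_mul_self _ _), h.sc_L_X]

end IsGlOsc

variable [Fintype I]

/-- The operator `z - ∑ x_k ∂_k`. -/
def opA (X D : I → A) (z : A) : A := z - ∑ k, X k * D k

/-- The operators `x_j z - ∑ ± x_k L_jk`. -/
def opY (q : I → ZMod 2) (X D : I → A) (r : I → I → A) (z : A) (j : I) : A :=
  X j * z - ∑ k, ksgn (q j) (q k) • (X k * opL X D r j k)

namespace IsGlOsc

/-- `∑ x_k ∂_k` is the even Euler operator, so bracketing with `opA` measures minus the degree in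
the variables. -/
theorem sc_A_X (h : IsGlOsc q X D r z) (i : I) : sc 1 (opA X D z) (X i) = - X i := by
  rw [opA, sc_sub_left, sc_one_eq_zero (h.zX i), sc_sum_left, zero_sub]
  have : ∀ k, sc 1 (X k * D k) (X i) = if k = i then X k else 0 := by
    intro k
    have := sc_mul_left (ksgn (q k) (q i)) (ksgn (q k) (q i)) (X k) (D k) (X i)
    rw [ksgn_mul_self, h.osc.DX, h.osc.XX] at this
    rw [this]; split_ifs <;> simp
  simp [this]

theorem sc_A_D (h : IsGlOsc q X D r z) (i : I) : sc 1 (opA X D z) (D i) = D i := by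
  rw [opA, sc_sub_left, sc_one_eq_zero (h.zD i), sc_sum_left, zero_sub]
  have : ∀ k, sc 1 (X k * D k) (D i) = - if i = k then D k else 0 := by
    intro k
    have := sc_mul_left (ksgn (q k) (q i)) (ksgn (q k) (q i)) (X k) (D k) (D i)
    rw [ksgn_mul_self, h.osc.DD, h.sc_X_D] at this
    rw [this]
    split_ifs
    · rw [smul_mul_assoc, one_mul, smul_smul, mul_neg, ksgn_mul_self]
      simp
    · simp
  simp [this]

theorem sc_A_r (h : IsGlOsc q X D r z) (i j : I) : sc 1 (opA X D z) (r i j) = 0 := by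
  refine sc_eq_zero_swap (by norm_num) ?_
  rw [opA, sc_sub_right, sc_one_eq_zero (h.zr i j).symm, sc_sum_right, zero_sub, neg_eq_zero]
  refine Finset.sum_eq_zero fun k _ => ?_
  have := sc_mul_right (ksgn (q i + q j) (q k)) (ksgn (q i + q j) (q k)) (r i j) (X k) (D k)
  rw [ksgn_mul_self, h.rX, h.rD] at this
  simpa using this

theorem sc_A_L (h : IsGlOsc q X D r z) (i j : I) : sc 1 (opA X D z) (opL X D r i j) = 0 := by
  rw [opL, sc_add_right, h.sc_A_r, add_zero]
  have := sc_mul_right 1 1 (opA X D z) (X i) (D j)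
  rw [h.sc_A_X, h.sc_A_D, mul_one] at this
  rw [this]; simp

theorem commute_z_A (h : IsGlOsc q X D r z) : Commute z (opA X D z) :=
  (Commute.refl z).sub_right (Commute.sum_right _ _ _ fun k _ => (h.zX k).mul_right (h.zD k))

theorem commute_z_Y (h : IsGlOsc q X D r z) (j : I) : Commute z (opY q X D r z j) :=
  ((h.zX j).mul_right (Commute.refl z)).sub_right
    (Commute.sum_right _ _ _ fun k _ =>
      ((h.zX k).mul_right (h.commute_z_L j k)).smul_right _)

theorem sc_A_Y (h : IsGlOsc q X D r z) (j : I) :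
    sc 1 (opA X D z) (opY q X D r z j) = - opY q X D r z j := by
  have h1 : sc 1 (opA X D z) (X j * z) = - (X j * z) := by
    have := sc_mul_right 1 1 (opA X D z) (X j) z
    rw [h.sc_A_X, sc_one_eq_zero h.commute_z_A.symm, mul_one] at this
    rw [this]; simp
  have h2 : ∀ k, sc 1 (opA X D z) (X k * opL X D r j k) = - (X k * opL X D r j k) := by
    intro k
    have := sc_mul_right 1 1 (opA X D z) (X k) (opL X D r j k)
    rw [h.sc_A_X, h.sc_A_L, mul_one] at this
    rw [this]; simp
  rw [opY, sc_sub_right, h1, sc_sum_right]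
  simp only [sc_smul_right, h2, smul_neg, Finset.sum_neg_distrib]
  abel

theorem sc_D_Y (h : IsGlOsc q X D r z) (i j : I) :
    sc (ksgn (q i) (q j)) (D i) (opY q X D r z j) =
      (if i = j then opA X D z else 0) - ksgn (q i) (q j) • opL X D r j i := by
  have h1 : sc (ksgn (q i) (q j)) (D i) (X j * z) = if i = j then z else 0 := by
    have := sc_mul_right (ksgn (q i) (q j)) 1 (D i) (X j) z
    rw [h.osc.DX, sc_one_eq_zero (h.zD i).symm, mul_one] at this
    rw [this]; split_ifs <;> simp
  have h2 : ∀ k, sc (ksgn (q i) (q j)) (D i) (X k * opL X D r j k) =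
      (if i = k then opL X D r j k else 0) +
        (if i = j then ksgn (q i) (q k) • (X k * D k) else 0) := by
    intro k
    -- The Leibniz rule wants the sign as a product over the factors `x_k` and `L_jk`; the extra
    -- sign of `k` occurs twice and squares to 1.
    have e1 : ksgn (q i) (q j) = ksgn (q i) (q k) * ksgn (q i) (q j + q k) := by
      rw [ksgn_add_right]; linear_combination (-ksgn (q i) (q j)) * ksgn_mul_self (q i) (q k)
    have e2 : sc (ksgn (q i) (q j + q k)) (D i) (opL X D r j k) = if i = j then D k else 0 := by
      rw [ksgn_comm, sc_swap (ksgn_mul_self _ _), h.sc_L_D, smul_smul, neg_mul_neg,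
        ksgn_mul_self, one_smul]
      simp only [eq_comm]
    rw [e1, sc_mul_right, h.osc.DX, e2]
    split_ifs <;> simp
  rw [opY, sc_sub_right, h1, sc_sum_right]
  simp only [sc_smul_right, h2, smul_add, Finset.sum_add_distrib]
  have h3 : (∑ k, ksgn (q j) (q k) • if i = k then opL X D r j k else 0) =
      ksgn (q i) (q j) • opL X D r j i := by
    simp only [smul_ite, smul_zero]
    rw [Finset.sum_ite_eq, if_pos (Finset.mem_univ _), ksgn_comm]
  have h4 : (∑ k, ksgn (q j) (q k) • if i = j then ksgn (q i) (q k) • (X k * D k) else 0) =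
      if i = j then ∑ k, X k * D k else 0 := by
    split_ifs with hij
    · subst hij
      simp only [smul_smul, ksgn_mul_self, one_smul]
    · simp
  rw [h3, h4, opA]
  split_ifs <;> abel

/-- The `Y_k` transform like the variables `x_k`. In the sum, the replacement of the contracted
index in `x_l` cancels against its replacement in `L_kl`, and only the free index `k` is affected.
-/
theorem sc_L_Y (h : IsGlOsc q X D r z) (i j k : I) :
    sc (ksgn (q i + q j) (q k)) (opL X D r i j) (opY q X D r z k) =
      if j = k then opY q X D r z i else 0 := by
  have h1 : sc (ksgn (q i + q j) (q k)) (opL X D r i j) (X k * z) =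
      if j = k then X i * z else 0 := by
    have := sc_mul_right (ksgn (q i + q j) (q k)) 1 (opL X D r i j) (X k) z
    rw [h.sc_L_X, sc_one_eq_zero (h.commute_z_L i j).symm, mul_one] at this
    rw [this]; split_ifs <;> simp
  have h2 : ∀ l, ksgn (q k) (q l) •
      sc (ksgn (q i + q j) (q k)) (opL X D r i j) (X l * opL X D r k l) =
      (if j = l then ksgn (q k) (q j) • (X i * opL X D r k j) else 0) +
        (if j = k then ksgn (q i) (q l) • (X l * opL X D r i l) else 0) -
        (if i = l then ksgn (q k) (q j) • (X i * opL X D r k j) else 0) := by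
    intro l
    have e1 : ksgn (q i + q j) (q k) = ksgn (q i + q j) (q l) * ksgn (q i + q j) (q k + q l) := by
      rw [ksgn_add_right]
      linear_combination (-ksgn (q i + q j) (q k)) * ksgn_mul_self (q i + q j) (q l)
    rw [e1, sc_mul_right, h.sc_L_X, h.sc_L_L]
    have s1 : j = k → ksgn (q k) (q l) * ksgn (q i + q j) (q l) = ksgn (q i) (q l) := by
      rintro rfl
      generalize q i = a; generalize q j = b; generalize q l = c; revert a b c; decide
    have s2 : i = l → ksgn (q k) (q l) * ksgn (q i + q j) (q k) = ksgn (q k) (q j) := by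
      rintro rfl
      generalize q i = a; generalize q j = b; generalize q k = c; revert a b c; decide
    have s3 : ksgn (q i + q j) (q l) * ksgn (q i + q j) (q k + q l) = ksgn (q i + q j) (q k) :=
      e1.symm
    have t1 : (ksgn (q k) (q l)) • ((if j = l then X i else 0) * opL X D r k l) =
        if j = l then ksgn (q k) (q j) • (X i * opL X D r k j) else 0 := by
      split_ifs with hh
      · subst hh; rfl
      · simp
    have t2 : ksgn (q k) (q l) • ksgn (q i + q j) (q l) • (X l *
        (if j = k then opL X D r i l else 0)) =
        if j = k then ksgn (q i) (q l) • (X l * opL X D r i l) else 0 := by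
      split_ifs with hh
      · rw [smul_smul, s1 hh]
      · simp
    have t3 : ksgn (q k) (q l) • ksgn (q i + q j) (q l) • (X l *
        (ksgn (q i + q j) (q k + q l) • if i = l then opL X D r k j else 0)) =
        if i = l then ksgn (q k) (q j) • (X i * opL X D r k j) else 0 := by
      split_ifs with hh
      · rw [mul_smul_comm, smul_smul _ _ (X l * _), s3, smul_smul, s2 hh, hh]
      · simp
    rw [smul_add, t1, mul_sub, smul_sub, smul_sub, t2, t3]
    abel
  rw [opY, sc_sub_right, h1, sc_sum_right]
  simp only [sc_smul_right, h2, Finset.sum_sub_distrib, Finset.sum_add_distrib,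
    Finset.sum_ite_eq, Finset.mem_univ, if_true]
  split_ifs
  · rw [opY]; abel
  · simp

/-- The `x_i` are not among the operators of `gl(k+1)`; this bracket serves the computation of
`sc_Y_Y`. -/
theorem sc_X_Y (h : IsGlOsc q X D r z) (i j : I) :
    sc (ksgn (q i) (q j)) (X i) (opY q X D r z j) = X i * X j := by
  have h1 : sc (ksgn (q i) (q j)) (X i) (X j * z) = 0 := by
    have := sc_mul_right (ksgn (q i) (q j)) 1 (X i) (X j) z
    rw [h.osc.XX, sc_one_eq_zero (h.zX i).symm, mul_one] at this
    rw [this]; simp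
  have h2 : ∀ k, ksgn (q j) (q k) • sc (ksgn (q i) (q j)) (X i) (X k * opL X D r j k) =
      - if k = i then X i * X j else 0 := by
    intro k
    have e1 : ksgn (q i) (q j) = ksgn (q i) (q k) * ksgn (q i) (q j + q k) := by
      rw [ksgn_add_right]; linear_combination (-ksgn (q i) (q j)) * ksgn_mul_self (q i) (q k)
    rw [e1, sc_mul_right, h.osc.XX, h.sc_X_L]
    split_ifs with hk
    · subst hk
      have s : ksgn (q j) (q k) * (ksgn (q k) (q k) * ksgn (q k) (q j + q k)) = 1 := by
        generalize q j = a; generalize q k = b; revert a b; decide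
      rw [zero_mul, zero_add, mul_smul_comm, smul_smul, smul_smul]
      rw [mul_neg, neg_smul, mul_assoc, s, one_smul]
    · simp
  rw [opY, sc_sub_right, h1, sc_sum_right]
  simp only [sc_smul_right, h2, Finset.sum_neg_distrib, Finset.sum_ite_eq', Finset.mem_univ,
    if_true]
  simp

/-- The term `x_i z` of `Y_i` contributes `x_i x_j z`. The sum in `Y_i` contributes `± x_j (Y_i + ∑
± x_k L_ik) = ± x_j x_i z`, which is the same element, and the two are subtracted. -/
theorem sc_Y_Y (h : IsGlOsc q X D r z) (i j : I) :
    sc (ksgn (q i) (q j)) (opY q X D r z i) (opY q X D r z j) = 0 := by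
  have h1 : sc (ksgn (q i) (q j)) (X i * z) (opY q X D r z j) = X i * X j * z := by
    have := sc_mul_left (ksgn (q i) (q j)) 1 (X i) z (opY q X D r z j)
    rw [h.sc_X_Y, sc_one_eq_zero (h.commute_z_Y j), mul_one] at this
    rw [this]; simp
  have hX : ∀ a b, X a * X b = ksgn (q a) (q b) • (X b * X a) := fun a b => by
    rw [mul_eq_of_sc (h.osc.XX a b), add_zero]
  have h2 : ∀ k, ksgn (q i) (q k) • sc (ksgn (q i) (q j)) (X k * opL X D r i k)
      (opY q X D r z j) =
      (if k = j then ksgn (q i) (q j) • (X j * opY q X D r z i) else 0) +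
        ksgn (q i) (q j) • (X j * ksgn (q i) (q k) • (X k * opL X D r i k)) := by
    intro k
    have e1 : ksgn (q i) (q j) = ksgn (q k) (q j) * ksgn (q i + q k) (q j) := by
      rw [ksgn_add_left]; linear_combination (-ksgn (q i) (q j)) * ksgn_mul_self (q k) (q j)
    have e2 : ksgn (q i) (q k) • ksgn (q i + q k) (q j) • (X k * X j * opL X D r i k) =
        ksgn (q i) (q j) • (X j * ksgn (q i) (q k) • (X k * opL X D r i k)) := by
      rw [hX k j, smul_mul_assoc, mul_smul_comm, smul_smul, smul_smul, smul_smul, mul_assoc (X j)]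
      congr 1
      generalize q i = a; generalize q j = b; generalize q k = c; revert a b c; decide
    rw [e1, sc_mul_left, h.sc_X_Y, h.sc_L_Y, ← e1, smul_add, e2]
    congr 1
    split_ifs with hk
    · subst hk; rfl
    · simp
  have h3 : (∑ k, ksgn (q i) (q k) • (X k * opL X D r i k)) = X i * z - opY q X D r z i := by
    rw [opY]; abel
  rw [opY.eq_def q X D r z i, sc_sub_left, h1, sc_sum_left]
  simp only [sc_smul_left, h2, Finset.sum_add_distrib, Finset.sum_ite_eq', Finset.mem_univ,
    if_true]
  rw [← Finset.smul_sum, ← Finset.mul_sum, h3, ← smul_add, ← mul_add, add_sub_cancel, hX i j,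
    smul_mul_assoc, mul_assoc, sub_self]

/-- In characteristic two, this does not follow from `sc_Y_Y`. -/
theorem Y_sq (h : IsGlOsc q X D r z) (i : I) (hi : q i = 1) :
    opY q X D r z i * opY q X D r z i = 0 := by
  set Y := opY q X D r z i with hY
  set S := ∑ k, ksgn (q i) (q k) • (X k * opL X D r i k) with hS
  have hYS : Y = X i * z - S := rfl
  have hXi := h.osc.X_sq i hi
  have hX : ∀ a b, X a * X b = ksgn (q a) (q b) • (X b * X a) := fun a b => by
    rw [mul_eq_of_sc (h.osc.XX a b), add_zero]
  have hXXL : ∑ k, X k * X i * opL X D r i k = X i * S := by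
    rw [hS, Finset.mul_sum]
    refine Finset.sum_congr rfl fun k _ => ?_
    rw [hX k i, smul_mul_assoc, mul_smul_comm, mul_assoc, ksgn_comm]
  -- the quadratic part
  have hquad : ∑ k, X k * S * opL X D r i k = - (X i * S) := by
    have e : ∀ k, X k * S * opL X D r i k =
        ∑ l, ksgn (q i) (q l) • (X k * X l * (opL X D r i l * opL X D r i k)) := by
      intro k
      rw [hS, Finset.mul_sum, Finset.sum_mul]
      refine Finset.sum_congr rfl fun l _ => ?_
      simp only [mul_smul_comm, smul_mul_assoc, mul_assoc]
    have e' : - (X i * S) =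
        ∑ k, ∑ l, if l = i then - (X k * X l * opL X D r i k) else 0 := by
      simp only [Finset.sum_ite_eq', Finset.mem_univ, if_true, Finset.sum_neg_distrib, hXXL]
    rw [Finset.sum_congr rfl fun k _ => e k, e', ← sub_eq_zero, ← Finset.sum_sub_distrib]
    simp only [← Finset.sum_sub_distrib]
    rw [← Finset.sum_product']
    have diag : ∀ k, ksgn (q i) (q k) • (X k * X k * (opL X D r i k * opL X D r i k)) -
        (if k = i then - (X k * X k * opL X D r i k) else 0) = 0 := by
      intro k
      have hk : q k = 0 ∨ q k = 1 := by generalize q k = a; revert a; decide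
      rcases hk with hk | hk
      · have hki : k ≠ i := by rintro rfl; rw [hi] at hk; exact absurd hk (by decide)
        rw [h.L_sq i k (by rw [hi, hk]; decide), if_neg hki]
        simp
      · rw [h.osc.X_sq k hk]; simp
    -- The terms at `(k, l)` and `(l, k)` cancel and the diagonal terms vanish one by one, so the
    -- double sum is zero without dividing by 2.
    refine Finset.sum_involution (fun p _ => (p.2, p.1)) ?_ ?_ ?_ ?_
    · rintro ⟨k, l⟩ -
      have hLL : opL X D r i l * opL X D r i k =
          ksgn (q i + q l) (q i + q k) • (opL X D r i k * opL X D r i l) +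
            ((if l = i then opL X D r i k else 0) -
              ksgn (q i + q l) (q i + q k) • (if i = k then opL X D r i l else 0)) :=
        mul_eq_of_sc (h.sc_L_L i l i k)
      have s1 : ksgn (q i) (q k) * ksgn (q l) (q k) +
          ksgn (q i) (q l) * ksgn (q i + q l) (q i + q k) = 0 := by
        rw [hi]; generalize q k = a; generalize q l = b; revert a b; decide
      have hki : i = k → ksgn (q i) (q l) * ksgn (q i + q l) (q i + q k) = ksgn (q l) (q k) := by
        rintro rfl; rw [hi]; generalize q l = a; revert a; decide
      have hli : l = i → ksgn (q i) (q l) = -1 := by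
        rintro rfl; rw [hi]; decide
      simp only
      rw [hX l k, hLL]
      have t1 : ksgn (q i) (q l) • (X k * X l * (if l = i then opL X D r i k else 0)) =
          if l = i then - (X k * X l * opL X D r i k) else 0 := by
        split_ifs with hh
        · rw [hli hh, neg_smul, one_smul]
        · simp
      have t2 : (ksgn (q i) (q l) * ksgn (q i + q l) (q i + q k)) •
          (X k * X l * (if i = k then opL X D r i l else 0)) =
          -if k = i then - ((ksgn (q l) (q k) • (X k * X l)) * opL X D r i l) else 0 := by
        by_cases hh : i = k
        · rw [if_pos hh, if_pos hh.symm, hki hh, smul_mul_assoc, neg_neg]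
        · rw [if_neg hh, if_neg (Ne.symm hh)]; simp
      simp only [mul_add, mul_sub, smul_add, smul_sub, mul_smul_comm, smul_mul_assoc, smul_smul,
        t1, t2]
      linear_combination (norm := module) s1 • (X k * X l * (opL X D r i k * opL X D r i l))
    · rintro ⟨k, l⟩ - hne heq
      simp only [Prod.mk.injEq] at heq
      obtain ⟨rfl, -⟩ := heq
      exact hne (diag _)
    · intros; simp
    · intros; rfl
  have hLY : ∀ k, opL X D r i k * Y =
      ksgn (q i + q k) (q i) • (Y * opL X D r i k) + if k = i then Y else 0 := fun k =>
    mul_eq_of_sc (h.sc_L_Y i k i)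
  have hXiY : X i * Y = - (X i * S) := by
    rw [hYS, mul_sub, ← mul_assoc, hXi]; simp
  have hzY : z * Y = Y * z := h.commute_z_Y i
  -- `Y` is moved to the left of each `L_ik`. The correction from `k = i` is `X i * S`, and it
  -- cancels the quadratic part.
  have hSY : S * Y = - (X i * S * z) := by
    have e : ∀ k, ksgn (q i) (q k) • (X k * opL X D r i k) * Y =
        - (X k * X i * opL X D r i k * z) + X k * S * opL X D r i k +
          (if k = i then X i * S else 0) := by
      intro k
      have s : ksgn (q i) (q k) * ksgn (q i + q k) (q i) = -1 := by
        rw [hi]; generalize q k = a; revert a; decide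
      rw [smul_mul_assoc, mul_assoc, hLY, mul_add, smul_add, mul_smul_comm, smul_smul, s,
        ← mul_assoc, hYS, mul_sub, sub_mul]
      have t : X k * (X i * z) * opL X D r i k = X k * X i * opL X D r i k * z := by
        rw [← mul_assoc, mul_assoc, (h.commute_z_L i k).eq, mul_assoc, mul_assoc, mul_assoc]
      rw [t, ← hYS]
      split_ifs with hk
      · subst hk
        rw [hXiY, hi]
        simp
        abel
      · simp; abel
    rw [hS, Finset.sum_mul, Finset.sum_congr rfl fun k _ => e k]
    simp only [Finset.sum_add_distrib, Finset.sum_ite_eq', Finset.mem_univ, if_true,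
      Finset.sum_neg_distrib, hquad]
    rw [← Finset.sum_mul, hXXL]
    abel
  calc Y * Y = (X i * z - S) * Y := by rw [← hYS]
    _ = 0 := by
      rw [sub_mul, mul_assoc, hzY, ← mul_assoc, hXiY, hSY]
      simp

end IsGlOsc

end Induction

/-! ### From `gl(k)` to `gl(k+1)` -/

section Enlarge

variable {A : Type*} [Ring A] {k : ℕ}

/-- The operators of the larger general linear Lie superalgebra. -/
def opE (q : Fin k → ZMod 2) (X D : Fin k → A) (r : Fin k → Fin k → A) (z : A) :
    Fin (k + 1) → Fin (k + 1) → A :=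
  Fin.cons (Fin.cons (opA X D z) D) fun i => Fin.cons (opY q X D r z i) (opL X D r i)

/-- Distinguishing index zero from successors gives sixteen kinds of bracket, each computed above
directly or with its arguments swapped, and four kinds of square. The new index has parity 0. -/
theorem IsGlOsc.isGl_opE {q : Fin k → ZMod 2} {X D : Fin k → A} {r : Fin k → Fin k → A} {z : A}
    (h : IsGlOsc q X D r z) : IsGl (Fin.cons 0 q : Fin (k + 1) → ZMod 2) (opE q X D r z) := by
  have hA1 : (1 : ℤ) * 1 = 1 := one_mul 1
  constructor
  · intro i j k l
    refine Fin.cases ?_ (fun i => ?_) i <;> refine Fin.cases ?_ (fun j => ?_) j <;>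
    refine Fin.cases ?_ (fun k => ?_) k <;> refine Fin.cases ?_ (fun l => ?_) l <;>
    simp only [opE, Fin.cons_zero, Fin.cons_succ, Fin.succ_inj, Fin.succ_ne_zero,
      (Fin.succ_ne_zero _).symm, if_true, if_false, add_zero, zero_add, ksgn_zero_left,
      ksgn_zero_right, one_smul, sub_zero, smul_zero, sub_self, zero_sub]
    · exact sc_one_eq_zero (Commute.refl _)
    · exact h.sc_A_D l
    · exact h.sc_A_Y k
    · exact h.sc_A_L k l
    · rw [sc_swap hA1, h.sc_A_D]; simp
    · exact h.osc.DD j l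
    · exact h.sc_D_Y j k
    · rw [ksgn_comm, sc_swap (ksgn_mul_self _ _), h.sc_L_D, smul_smul, neg_mul_neg, ksgn_mul_self,
        one_smul]
      simp only [eq_comm]
    · rw [sc_swap hA1, h.sc_A_Y]; simp
    · rw [ksgn_comm, sc_swap (ksgn_mul_self _ _), h.sc_D_Y, smul_sub, smul_smul, neg_mul,
        ksgn_mul_self]
      simp only [eq_comm, neg_smul, one_smul, sub_neg_eq_add]
      abel
    · exact h.sc_Y_Y i k
    · rw [ksgn_comm, sc_swap (ksgn_mul_self _ _), h.sc_L_Y, neg_smul]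
      simp only [eq_comm]
    · exact sc_eq_zero_swap hA1 (h.sc_A_L i j)
    · rw [h.sc_L_D, neg_smul]
    · exact h.sc_L_Y i j k
    · exact h.sc_L_L i j k l
  · intro i j
    refine Fin.cases ?_ (fun i => ?_) i <;> refine Fin.cases ?_ (fun j => ?_) j <;>
    simp only [opE, Fin.cons_zero, Fin.cons_succ, add_zero, zero_add] <;> intro hij
    · exact absurd hij (by decide)
    · exact h.osc.D_sq j hij
    · exact h.Y_sq i hij
    · exact h.L_sq i j hij

end Enlarge

/-! ### Parity operators and adjoining variables to a module -/

section Modules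

variable {R : Type*} [CommRing R] {M : Type*} [AddCommGroup M] [Module R M]

/-- The operator `T` has parity `a` with respect to the parity operator `Γ`. -/
def HasPar {A : Type*} [Ring A] (Γ : A) (a : ZMod 2) (T : A) : Prop := Γ * T = ksgn 1 a • (T * Γ)

theorem HasPar.mul {A : Type*} [Ring A] {Γ : A} {a b : ZMod 2} {S T : A} (hS : HasPar Γ a S)
    (hT : HasPar Γ b T) : HasPar Γ (a + b) (S * T) := by
  unfold HasPar at *
  rw [← mul_assoc, hS, smul_mul_assoc, mul_assoc, hT, mul_smul_comm, smul_smul, ksgn_add_right,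
    mul_assoc]

theorem HasPar.add {A : Type*} [Ring A] {Γ : A} {a : ZMod 2} {S T : A} (hS : HasPar Γ a S)
    (hT : HasPar Γ a T) : HasPar Γ a (S + T) := by
  unfold HasPar at *
  rw [mul_add, add_mul, hS, hT, smul_add]

theorem HasPar.sub {A : Type*} [Ring A] {Γ : A} {a : ZMod 2} {S T : A} (hS : HasPar Γ a S)
    (hT : HasPar Γ a T) : HasPar Γ a (S - T) := by
  unfold HasPar at *
  rw [mul_sub, sub_mul, hS, hT, smul_sub]

theorem HasPar.smul {A : Type*} [Ring A] {Γ : A} {a : ZMod 2} {T : A} (c : ℤ)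
    (hT : HasPar Γ a T) : HasPar Γ a (c • T) := by
  unfold HasPar at *
  rw [mul_smul_comm, smul_mul_assoc, hT, smul_comm]

theorem HasPar.sum {A : Type*} [Ring A] {Γ : A} {a : ZMod 2} {I : Type*} {s : Finset I}
    {T : I → A} (hT : ∀ i ∈ s, HasPar Γ a (T i)) : HasPar Γ a (∑ i ∈ s, T i) := by
  unfold HasPar at *
  rw [Finset.mul_sum, Finset.sum_mul, Finset.smul_sum]
  exact Finset.sum_congr rfl hT

/-- A module `M'` over the super Weyl algebra in the variables `X i`, of the form `M[X]`: the
operators on `M` act through `Θ` on the coefficients, `ν` is the inclusion of the constants, and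
`φ` is the evaluation at zero. -/
structure OscExt {I : Type*} [DecidableEq I] (q : I → ZMod 2) (Γ : Module.End R M)
    (M' : Type*) [AddCommGroup M'] [Module R M'] where
  Γ' : Module.End R M'
  Θ : Module.End R M →ₐ[R] Module.End R M'
  X : I → Module.End R M'
  D : I → Module.End R M'
  ν : M →ₗ[R] M'
  φ : M' →ₗ[R] M
  par_sq : Γ' * Γ' = 1
  par_X : ∀ i, HasPar Γ' (q i) (X i)
  par_D : ∀ i, HasPar Γ' (q i) (D i)
  par_Θ : ∀ a T, HasPar Γ a T → HasPar Γ' a (Θ T)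
  osc : IsOsc q X D
  ΘX : ∀ a T i, HasPar Γ a T → sc (ksgn a (q i)) (Θ T) (X i) = 0
  ΘD : ∀ a T i, HasPar Γ a T → sc (ksgn a (q i)) (Θ T) (D i) = 0
  Θν : ∀ T x, Θ T (ν x) = ν (T x)
  φΘ : ∀ T x, φ (Θ T x) = T (φ x)
  φν : ∀ x, φ (ν x) = x
  φX : ∀ i x, φ (X i x) = 0
  Dν : ∀ i x, D i (ν x) = 0

/-- One odd variable. -/
def oddExt {q : ZMod 2} (hq : q = 1) (Γ : Module.End R M) (hΓ : Γ * Γ = 1) :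
    OscExt (fun _ : Unit => q) Γ (M × M) where
  Γ' := LinearMap.prodMap Γ (-Γ)
  Θ := AlgHom.ofLinearMap
    { toFun := fun T => LinearMap.prodMap T T
      map_add' := fun S T => by ext <;> simp
      map_smul' := fun c T => by ext <;> simp } (by ext <;> simp) (fun S T => by ext <;> simp)
  -- `M × M` stands for `M ⊕ Mξ`. Coefficients act diagonally without sign, so the Koszul sign for
  -- passing `ξ` is supplied by the factor `Γ` in `X` and `D`.
  X := fun _ => LinearMap.prod 0 (Γ ∘ₗ LinearMap.fst R M M)
  D := fun _ => LinearMap.prod (Γ ∘ₗ LinearMap.snd R M M) 0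
  ν := LinearMap.inl R M M
  φ := LinearMap.fst R M M
  par_sq := by
    have h : ∀ x, Γ (Γ x) = x := fun x => LinearMap.congr_fun hΓ x
    ext <;> simp [h]
  par_X := fun _ => by subst hq; ext <;> simp
  par_D := fun _ => by subst hq; ext <;> simp
  par_Θ := fun a T hT => by
    have h : ∀ x, Γ (T x) = ksgn 1 a • T (Γ x) := fun x => LinearMap.congr_fun hT x
    ext <;> simp [h]
  osc := by
    have h : ∀ x, Γ (Γ x) = x := fun x => LinearMap.congr_fun hΓ x
    subst hq
    constructor <;> intros <;> ext <;> simp [sc, h]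
  ΘX := fun a T _ hT => by
    have h : ∀ x, Γ (T x) = ksgn 1 a • T (Γ x) := fun x => LinearMap.congr_fun hT x
    subst hq
    ext <;> simp [sc, h, ksgn_comm a 1, smul_smul, ksgn_mul_self]
  ΘD := fun a T _ hT => by
    have h : ∀ x, Γ (T x) = ksgn 1 a • T (Γ x) := fun x => LinearMap.congr_fun hT x
    subst hq
    ext <;> simp [sc, h, ksgn_comm a 1, smul_smul, ksgn_mul_self]
  Θν := fun T x => by simp
  φΘ := fun T x => by simp
  φν := fun x => by simp
  φX := fun _ x => by simp
  Dν := fun _ x => by simp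

/-- One even variable. -/
noncomputable def evenExt {q : ZMod 2} (hq : q = 0) (Γ : Module.End R M) (hΓ : Γ * Γ = 1) :
    OscExt (fun _ : Unit => q) Γ (ℕ →₀ M) where
  Γ' := Finsupp.mapRange.linearMap Γ
  Θ := AlgHom.ofLinearMap
    { toFun := fun T => Finsupp.mapRange.linearMap T
      map_add' := fun S T => by ext; simp
      map_smul' := fun c T => by ext; simp } (by ext; simp) (fun S T => by ext; simp)
  X := fun _ => Finsupp.lsum R fun i => Finsupp.lsingle (i + 1)
  -- At `i = 0` the truncated exponent `i - 1` is harmless, because the coefficient `i` vanishes.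
  D := fun _ => Finsupp.lsum R fun i => i • Finsupp.lsingle (i - 1)
  ν := Finsupp.lsingle 0
  φ := Finsupp.lapply 0
  par_sq := by
    have h : ∀ x, Γ (Γ x) = x := fun x => LinearMap.congr_fun hΓ x
    ext; simp [h]
  par_X := fun _ => by subst hq; unfold HasPar; ext; simp
  par_D := fun _ => by subst hq; unfold HasPar; ext; simp
  par_Θ := fun a T hT => by
    have h : ∀ x, Γ (T x) = ksgn 1 a • T (Γ x) := fun x => LinearMap.congr_fun hT x
    unfold HasPar
    ext; simp [h]
  osc := by
    subst hq
    constructor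
    · intros; simp [sc]
    · intros; simp [sc]
    · rintro ⟨⟩ ⟨⟩
      have hX : ∀ n (x : M), Finsupp.lsum R (fun i => Finsupp.lsingle (R := R) (i + 1))
          (Finsupp.single n x) = Finsupp.single (n + 1) x := by simp
      have hD : ∀ n (x : M), Finsupp.lsum R (fun i => i • Finsupp.lsingle (R := R) (i - 1))
          (Finsupp.single n x) = n • Finsupp.single (n - 1) x := by simp
      refine Finsupp.lhom_ext fun n x => ?_
      simp only [sc, ksgn_zero_left, one_smul, LinearMap.sub_apply, Module.End.mul_apply, hX, hD,
        map_nsmul, if_true, Module.End.one_apply]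
      cases n
      · simp
      · simp only [Nat.add_sub_cancel]
        module
    · simp
    · simp
  ΘX := fun a T _ hT => by
    subst hq
    ext; simp [sc]
  ΘD := fun a T _ hT => by
    subst hq
    ext; simp [sc]
  Θν := fun T x => by simp
  φΘ := fun T x => by simp
  φν := fun x => by simp
  φX := fun _ x => by
    induction x using Finsupp.induction_linear <;> simp_all
  Dν := fun _ x => by simp

end Modules

section Modules

variable {R : Type*} [CommRing R] {M : Type*} [AddCommGroup M] [Module R M]

theorem map_sc {A B G : Type*} [Ring A] [Ring B] [FunLike G A B] [RingHomClass G A B] (f : G)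
    (c : ℤ) (x y : A) : f (sc c x y) = sc c (f x) (f y) := by
  simp only [sc, map_sub, map_mul, map_zsmul]

/-- Adding variables one at a time. -/
def OscExt.comp {k : ℕ} {q : Fin k → ZMod 2} {q₀ : ZMod 2} {Γ : Module.End R M}
    {M₁ M₂ : Type*} [AddCommGroup M₁] [Module R M₁] [AddCommGroup M₂] [Module R M₂]
    (E : OscExt q Γ M₁) (S : OscExt (fun _ : Unit => q₀) E.Γ' M₂) :
    OscExt (Fin.cons q₀ q : Fin (k + 1) → ZMod 2) Γ M₂ where
  Γ' := S.Γ'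
  Θ := S.Θ.comp E.Θ
  -- The new variable gets index zero and the old operators act on its coefficients through `S.Θ`;
  -- the mixed relations are thus `S.ΘX` and `S.ΘD`.
  X := Fin.cons (S.X ()) fun i => S.Θ (E.X i)
  D := Fin.cons (S.D ()) fun i => S.Θ (E.D i)
  ν := S.ν ∘ₗ E.ν
  φ := E.φ ∘ₗ S.φ
  par_sq := S.par_sq
  par_X := Fin.cases (S.par_X ()) fun i => S.par_Θ _ _ (E.par_X i)
  par_D := Fin.cases (S.par_D ()) fun i => S.par_Θ _ _ (E.par_D i)
  par_Θ := fun a T hT => S.par_Θ _ _ (E.par_Θ a T hT)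
  osc :=
    { XX := by
        refine Fin.cases (Fin.cases (S.osc.XX () ()) fun j => ?_) fun i =>
          Fin.cases (S.ΘX _ _ () (E.par_X i)) fun j => ?_
        · simp only [Fin.cons_zero, Fin.cons_succ]
          rw [ksgn_comm]
          exact sc_eq_zero_swap (ksgn_mul_self _ _) (S.ΘX _ _ () (E.par_X j))
        · simp only [Fin.cons_succ]
          rw [← map_sc, E.osc.XX, map_zero]
      DD := by
        refine Fin.cases (Fin.cases (S.osc.DD () ()) fun j => ?_) fun i =>
          Fin.cases (S.ΘD _ _ () (E.par_D i)) fun j => ?_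
        · simp only [Fin.cons_zero, Fin.cons_succ]
          rw [ksgn_comm]
          exact sc_eq_zero_swap (ksgn_mul_self _ _) (S.ΘD _ _ () (E.par_D j))
        · simp only [Fin.cons_succ]
          rw [← map_sc, E.osc.DD, map_zero]
      DX := by
        refine Fin.cases (Fin.cases (S.osc.DX () ()) fun j => ?_) fun i =>
          Fin.cases ?_ fun j => ?_
        · simp only [Fin.cons_zero, Fin.cons_succ, (Fin.succ_ne_zero _).symm, if_false]
          rw [ksgn_comm]
          exact sc_eq_zero_swap (ksgn_mul_self _ _) (S.ΘD _ _ () (E.par_X j))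
        · simp only [Fin.cons_zero, Fin.cons_succ, Fin.succ_ne_zero, if_false]
          exact S.ΘX _ _ () (E.par_D i)
        · simp only [Fin.cons_succ, Fin.succ_inj]
          rw [← map_sc, E.osc.DX]
          split_ifs <;> simp
      X_sq := Fin.cases (S.osc.X_sq ()) fun i hi => by
        simp only [Fin.cons_succ] at hi ⊢
        rw [← map_mul, E.osc.X_sq i hi, map_zero]
      D_sq := Fin.cases (S.osc.D_sq ()) fun i hi => by
        simp only [Fin.cons_succ] at hi ⊢
        rw [← map_mul, E.osc.D_sq i hi, map_zero] }
  ΘX := fun a T => Fin.cases (fun hT => S.ΘX a _ () (E.par_Θ a T hT)) fun i hT => by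
    simp only [Fin.cons_succ, AlgHom.comp_apply]
    rw [← map_sc, E.ΘX a T i hT, map_zero]
  ΘD := fun a T => Fin.cases (fun hT => S.ΘD a _ () (E.par_Θ a T hT)) fun i hT => by
    simp only [Fin.cons_succ, AlgHom.comp_apply]
    rw [← map_sc, E.ΘD a T i hT, map_zero]
  Θν := fun T x => by simp [S.Θν, E.Θν]
  φΘ := fun T x => by simp [S.φΘ, E.φΘ]
  φν := fun x => by simp [S.φν, E.φν]
  φX := Fin.cases (fun x => by simp [S.φX]) fun i x => by simp [S.φΘ, E.φX]
  Dν := Fin.cases (fun x => by simp [S.Dν]) fun i x => by simp [S.Θν, E.Dν]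

/-- No variables. -/
def OscExt.nil (q : Fin 0 → ZMod 2) (Γ : Module.End R M) (hΓ : Γ * Γ = 1) : OscExt q Γ M where
  Γ' := Γ
  Θ := AlgHom.id R _
  X := Fin.elim0
  D := Fin.elim0
  ν := LinearMap.id
  φ := LinearMap.id
  par_sq := hΓ
  par_X := fun i => i.elim0
  par_D := fun i => i.elim0
  par_Θ := fun _ _ hT => hT
  osc := ⟨fun i => i.elim0, fun i => i.elim0, fun i => i.elim0, fun i => i.elim0,
    fun i => i.elim0⟩
  ΘX := fun _ _ i => i.elim0
  ΘD := fun _ _ i => i.elim0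
  Θν := fun _ _ => rfl
  φΘ := fun _ _ => rfl
  φν := fun _ => rfl
  φX := fun i => i.elim0
  Dν := fun i => i.elim0

end Modules

-- Existence of highest weight modules over a commutative ring

universe u v

theorem exists_oscExt {R : Type v} [CommRing R] {M : Type u} [AddCommGroup M] [Module R M]
    (Γ : Module.End R M) (hΓ : Γ * Γ = 1) (k : ℕ) (q : Fin k → ZMod 2) :
    ∃ (M' : Type u) (_ : AddCommGroup M') (_ : Module R M'), Nonempty (OscExt q Γ M') := by
  induction k with
  | zero => exact ⟨M, _, _, ⟨OscExt.nil q Γ hΓ⟩⟩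
  | succ k ih =>
    obtain ⟨M₁, _, _, ⟨E⟩⟩ := ih (Fin.tail q)
    have hq : q 0 = 0 ∨ q 0 = 1 := by generalize q 0 = a; revert a; decide
    rw [← Fin.cons_self_tail q]
    rcases hq with hq | hq
    · exact ⟨_, _, _, ⟨E.comp (evenExt hq E.Γ' E.par_sq)⟩⟩
    · exact ⟨_, _, _, ⟨E.comp (oddExt hq E.Γ' E.par_sq)⟩⟩

/-- Over a commutative ring, there is a module over the general linear Lie superalgebra (with
parities `p`) with a highest weight vector `v` of weight `h` and a functional `φ` that vanishes on
the image of the strictly lower triangular matrices and takes the value `1` at `v`. -/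
theorem exists_highest_weight {R : Type u} [CommRing R] (k : ℕ) (p : Fin k → ZMod 2)
    (h : Fin k → R) :
    ∃ (M : Type u) (_ : AddCommGroup M) (_ : Module R M) (Γ : Module.End R M)
      (e : Fin k → Fin k → Module.End R M) (v : M) (φ : M →ₗ[R] R),
      Γ * Γ = 1 ∧ (∀ i j, HasPar Γ (p i + p j) (e i j)) ∧ IsGl p e ∧
      (∀ i j, i < j → e i j v = 0) ∧ (∀ i, e i i v = h i • v) ∧
      (∀ i j, j < i → ∀ x, φ (e i j x) = 0) ∧ φ v = 1 := by
  induction k with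
  | zero =>
    exact ⟨R, _, _, 1, fun i => i.elim0, 1, LinearMap.id, one_mul 1, fun i => i.elim0,
      ⟨fun i => i.elim0, fun i => i.elim0⟩, fun i => i.elim0, fun i => i.elim0,
      fun i => i.elim0, rfl⟩
  | succ k ih =>
    -- Shifting all parities by `p 0` makes the first index even, as `opE` requires; sums of two
    -- parities do not change.
    set q : Fin k → ZMod 2 := fun i => p i.succ + p 0 with hq
    have hqq : ∀ i j, q i + q j = p i.succ + p j.succ := by
      intro i j
      simp only [hq]
      generalize p i.succ = a; generalize p j.succ = b; generalize p 0 = c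
      revert a b c; decide
    obtain ⟨M, _, _, Γ, e, v, φ, hΓ, hpar, hgl, hup, hdiag, hlow, hv⟩ :=
      ih q (fun i => h i.succ)
    obtain ⟨M', _, _, ⟨E⟩⟩ := exists_oscExt Γ hΓ k q
    set z : Module.End R M' := algebraMap R _ (h 0)
    have hO : IsGlOsc q E.X E.D (fun i j => E.Θ (e i j)) z :=
      { osc := E.osc
        gl := ⟨fun i j k l => by
            rw [← map_sc, hgl.bracket, map_sub, map_zsmul]
            split_ifs <;> simp, fun i j hij => by rw [← map_mul, hgl.sq i j hij, map_zero]⟩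
        rX := fun i j l => E.ΘX _ _ l (hpar i j)
        rD := fun i j l => E.ΘD _ _ l (hpar i j)
        zX := fun i => Algebra.commutes _ _
        zD := fun i => Algebra.commutes _ _
        zr := fun i j => Algebra.commutes _ _ }
    have hcons : ∀ i j, (Fin.cons 0 q : Fin (k + 1) → ZMod 2) i +
        (Fin.cons 0 q : Fin (k + 1) → ZMod 2) j = p i + p j := by
      have h2 : ∀ a b : ZMod 2, a + b + b = a := by decide
      have h3 : ∀ a : ZMod 2, 0 = a + a := by decide
      refine Fin.cases (Fin.cases ?_ fun j => ?_) fun i => Fin.cases ?_ fun j => ?_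
      · simpa using h3 _
      · simp [hq, add_comm]
      · simp [hq]
      · simpa using hqq i j
    have hz : HasPar E.Γ' 0 z := by
      rw [HasPar, ksgn_zero_right, one_smul]
      exact (Algebra.commutes _ _).symm
    have addself : ∀ a : ZMod 2, a + a = 0 := by decide
    have hA : HasPar E.Γ' 0 (opA E.X E.D z) := hz.sub <| HasPar.sum fun i _ => by
      rw [← addself (q i)]
      exact (E.par_X i).mul (E.par_D i)
    have hL : ∀ i j, HasPar E.Γ' (q i + q j) (opL E.X E.D (fun i j => E.Θ (e i j)) i j) :=
      fun i j => ((E.par_X i).mul (E.par_D j)).add (E.par_Θ _ _ (hpar i j))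
    have hY : ∀ i, HasPar E.Γ' (q i) (opY q E.X E.D (fun i j => E.Θ (e i j)) z i) := by
      intro i
      refine HasPar.sub ?_ (HasPar.sum fun j _ => HasPar.smul _ ?_)
      · simpa using (E.par_X i).mul hz
      · have := (E.par_X j).mul (hL i j)
        have h2 : ∀ a b : ZMod 2, a + (b + a) = b := by decide
        rwa [h2] at this
    -- Constants are killed by all `∂_j`. Below the diagonal, every term begins with a variable,
    -- which dies at zero, or acts on the coefficients, where the old functional applies.
    refine ⟨M', _, _, E.Γ', opE q E.X E.D (fun i j => E.Θ (e i j)) z, E.ν v, φ ∘ₗ E.φ,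
      E.par_sq, ?_, hO.isGl_opE.congr hcons, ?_, ?_, ?_, ?_⟩
    · intro i j
      rw [← hcons]
      revert i j
      refine Fin.cases (Fin.cases ?_ fun j => ?_) fun i => Fin.cases ?_ fun j => ?_ <;>
      simp only [opE, Fin.cons_zero, Fin.cons_succ, add_zero, zero_add]
      · exact hA
      · exact E.par_D j
      · exact hY i
      · exact hL i j
    · refine Fin.cases (Fin.cases ?_ fun j => ?_) fun i => Fin.cases ?_ fun j => ?_ <;>
      simp only [opE, Fin.cons_zero, Fin.cons_succ] <;> intro hij
      · exact absurd hij (lt_irrefl _)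
      · exact E.Dν j v
      · exact absurd hij (Fin.not_lt_zero _)
      · simp [opL, E.Dν, E.Θν, hup i j (Fin.succ_lt_succ_iff.1 hij)]
    · refine Fin.cases ?_ fun i => ?_ <;> simp only [opE, Fin.cons_zero, Fin.cons_succ]
      · simp [opA, E.Dν, z]
      · simp [opL, E.Dν, E.Θν, hdiag]
    · refine Fin.cases (Fin.cases ?_ fun j => ?_) fun i => Fin.cases ?_ fun j => ?_ <;>
      simp only [opE, Fin.cons_zero, Fin.cons_succ, LinearMap.comp_apply] <;> intro hij x
      · exact absurd hij (lt_irrefl _)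
      · exact absurd hij (Fin.not_lt_zero _)
      · simp [opY, E.φX]
      · simp [opL, E.φX, E.φΘ, hlow i j (Fin.succ_lt_succ_iff.1 hij)]
    · simp [E.φν, hv]

/-! ### Generators and relations of the enveloping superalgebras -/

variable {m n : ℕ} {F : Type*} [Field F]

theorem U_induction (V : SubSuper m n F) {C : U V → Prop}
    (algebraMap : ∀ c : F, C (algebraMap F (U V) c)) (ι : ∀ x, C (ι V x))
    (mul : ∀ a b, C a → C b → C (a * b)) (add : ∀ a b, C a → C b → C (a + b)) (a : U V) : C a := by
  obtain ⟨t, rfl⟩ : ∃ t, mkU V t = a := RingQuot.mkAlgHom_surjective F (EnvRel V) a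
  induction t using TensorAlgebra.induction with
  | algebraMap c => simpa using algebraMap c
  | ι x => exact ι x
  | mul a b ha hb => simpa using mul _ _ ha hb
  | add a b ha hb => simpa using add _ _ ha hb

/-- Induction on words, one letter at a time from the left; it is used where letters are commuted
past a word in `N⁻`. -/
theorem U_induction_left (V : SubSuper m n F) {C : U V → Prop} (one : C 1)
    (smul : ∀ (c : F) a, C a → C (c • a)) (add : ∀ a b, C a → C b → C (a + b))
    (ι_mul : ∀ x a, C a → C (ι V x * a)) (a : U V) : C a := by
  suffices h : ∀ b, C b → C (a * b) by simpa using h 1 one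
  induction a using U_induction with
  | algebraMap c => intro b hb; rw [← Algebra.smul_def]; exact smul c b hb
  | ι x => exact ι_mul x
  | mul a a' ha ha' => intro b hb; rw [mul_assoc]; exact ha _ (ha' _ hb)
  | add a a' ha ha' => intro b hb; rw [add_mul]; exact add _ _ (ha _ hb) (ha' _ hb)

theorem toUg_ι (V : SubSuper m n F) (x : V.carrier) :
    toUg V (ι V x) = ι (g m n F) ⟨x, mem_g _⟩ := by
  rw [toUg, lift_ι]
  rfl

theorem counit_ι (V : SubSuper m n F) (x : V.carrier) : counit V (ι V x) = 0 := by
  rw [counit, lift_ι]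
  rfl

/-- Every matrix is a linear combination of matrix units. -/
theorem ι_g_eq_sum (x : (g m n F).carrier) :
    ι (g m n F) x = ∑ i, ∑ j, x.1 i j • (E i j : U (g m n F)) := by
  have hx : x = ∑ i, ∑ j, x.1 i j • (⟨Matrix.single i j 1, mem_g _⟩ : (g m n F).carrier) := by
    apply Subtype.ext
    simp only [AddSubmonoidClass.coe_finsetSum, Submodule.coe_smul, Matrix.smul_single,
      smul_eq_mul, mul_one]
    exact Matrix.matrix_eq_sum_single x.1
  conv_lhs => rw [hx]
  simp only [map_sum, map_smul, E]

theorem toUg_ι_eq_sum (V : SubSuper m n F) (x : V.carrier) :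
    toUg V (ι V x) = ∑ i, ∑ j, x.1 i j • (E i j : U (g m n F)) := by
  rw [toUg_ι, ι_g_eq_sum]

theorem isHomog_single (i j : Idx m n) :
    IsHomog (par i + par j) (Matrix.single i j (1 : F)) := by
  intro a b h
  by_contra hne
  refine h (Matrix.single_apply_of_ne _ _ _ _ _ ?_)
  rintro ⟨rfl, rfl⟩
  exact hne rfl

theorem sgn_smul {A : Type*} [AddCommGroup A] [Module F A] (a b : ZMod 2) (x : A) :
    sgn F a b • x = ksgn a b • x := by
  rw [← Int.cast_smul_eq_zsmul F, sgn, ksgn]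
  norm_num

theorem E_bracket (i j k l : Idx m n) :
    sc (ksgn (par i + par j) (par k + par l)) (E i j : U (g m n F)) (E k l) =
      (if j = k then E i l else 0) -
        ksgn (par i + par j) (par k + par l) • (if i = l then E k j else 0) := by
  have hz : ∃ z : (g m n F).carrier,
      z.1 = sbracket (par i + par j) (par k + par l) (Matrix.single i j (1 : F))
        (Matrix.single k l 1) := ⟨⟨_, mem_g _⟩, rfl⟩
  obtain ⟨z, hz⟩ := hz
  have h := ι_bracket (g m n F) (par i + par j) (par k + par l)
    ⟨Matrix.single i j 1, mem_g _⟩ ⟨Matrix.single k l 1, mem_g _⟩ z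
    (isHomog_single i j) (isHomog_single k l) hz
  rw [sc, ← sgn_smul (F := F), ← sgn_smul (F := F)]
  refine h.trans ?_
  have hz' : z = (if j = k then ⟨Matrix.single i l 1, mem_g _⟩ else 0) -
      sgn F (par i + par j) (par k + par l) •
        (if i = l then ⟨Matrix.single k j 1, mem_g _⟩ else 0) := by
    apply Subtype.ext
    rw [hz, sbracket]
    by_cases h1 : j = k <;> by_cases h2 : i = l
    · subst h1 h2; simp
    · subst h1
      rw [Matrix.single_mul_single_of_ne (h := Ne.symm h2)]; simp [h2]
    · subst h2
      rw [Matrix.single_mul_single_of_ne (h := h1)]; simp [h1]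
    · rw [Matrix.single_mul_single_of_ne (h := h1), Matrix.single_mul_single_of_ne (h := Ne.symm h2)]
      simp [h1, h2]
  rw [hz', map_sub, map_smul]
  split_ifs <;> simp [E]

theorem E_sq (i j : Idx m n) (h : par i + par j = 1) : (E i j : U (g m n F)) * E i j = 0 := by
  have hne : j ≠ i := by
    rintro rfl
    exact absurd h (by generalize par j = a; revert a; decide)
  have := ι_sq (g m n F) ⟨Matrix.single i j 1, mem_g _⟩ 0 (h ▸ isHomog_single i j)
    (by rw [Matrix.single_mul_single_of_ne (h := hne)]; rfl)
  rwa [map_zero] at this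

/-! ### Representations of `U(𝔤)` from matrix unit relations -/

section Lift

variable {A : Type*} [Ring A] [Algebra F A]

/-- The linear extension of a family of images of matrix units. -/
def glLin (F : Type*) [Field F] {A : Type*} [Ring A] [Algebra F A] (e : Idx m n → Idx m n → A) :
    Gl m n F →ₗ[F] A where
  toFun x := ∑ p : Idx m n × Idx m n, x p.1 p.2 • e p.1 p.2
  map_add' x y := by simp [add_smul, Finset.sum_add_distrib]
  map_smul' c x := by simp [mul_smul, Finset.smul_sum]

theorem glLin_apply (e : Idx m n → Idx m n → A) (x : Gl m n F) :
    glLin F e x = ∑ p : Idx m n × Idx m n, x p.1 p.2 • e p.1 p.2 := rfl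

theorem glLin_single (e : Idx m n → Idx m n → A) (i j : Idx m n) :
    glLin F e (Matrix.single i j 1) = e i j := by
  rw [glLin_apply, Finset.sum_eq_single (i, j)]
  · simp
  · rintro ⟨a, b⟩ - hne
    rw [Matrix.single_apply_of_ne, zero_smul]
    rintro ⟨rfl, rfl⟩
    exact hne rfl
  · simp

theorem glLin_mul_glLin (e : Idx m n → Idx m n → A) (x y : Gl m n F) :
    glLin F e x * glLin F e y = ∑ p : Idx m n × Idx m n, ∑ r : Idx m n × Idx m n,
      (x p.1 p.2 * y r.1 r.2) • (e p.1 p.2 * e r.1 r.2) := by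
  simp only [glLin_apply, Finset.sum_mul_sum, smul_mul_smul_comm]

theorem glLin_mul (e : Idx m n → Idx m n → A) (x y : Gl m n F) :
    glLin F e (x * y) = ∑ p : Idx m n × Idx m n, ∑ r : Idx m n × Idx m n,
      (x p.1 p.2 * y r.1 r.2) • (if p.2 = r.1 then e p.1 r.2 else 0) := by
  simp only [glLin_apply, Matrix.mul_apply, Fintype.sum_prod_type, Finset.sum_smul, smul_ite,
    smul_zero]
  refine Finset.sum_congr rfl fun i _ => ?_
  rw [Finset.sum_comm]
  refine Finset.sum_congr rfl fun k _ => ?_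
  rw [Finset.sum_comm]
  simp

/-- After expansion in matrix units, only places where both entries are nonzero matter, and there
homogeneity makes `a` and `b` the parities of the units. -/
theorem glLin_bracket {e : Idx m n → Idx m n → A} (he : IsGl par e) {a b : ZMod 2}
    {x y : Gl m n F} (hx : IsHomog a x) (hy : IsHomog b y) :
    glLin F e x * glLin F e y - sgn F a b • (glLin F e y * glLin F e x) =
      glLin F e (sbracket a b x y) := by
  rw [sbracket, map_sub, map_smul, glLin_mul, glLin_mul, glLin_mul_glLin, glLin_mul_glLin,
    Finset.sum_comm (f := fun p r : Idx m n × Idx m n => (y p.1 p.2 * x r.1 r.2) • _),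
    Finset.sum_comm (f := fun p r : Idx m n × Idx m n => (y p.1 p.2 * x r.1 r.2) • _)]
  simp only [Finset.smul_sum, ← Finset.sum_sub_distrib]
  refine Finset.sum_congr rfl fun p _ => Finset.sum_congr rfl fun r _ => ?_
  by_cases h1 : x p.1 p.2 = 0
  · simp [h1]
  by_cases h2 : y r.1 r.2 = 0
  · simp [h2]
  have hb := he.bracket p.1 p.2 r.1 r.2
  rw [hx _ _ h1, hy _ _ h2, sc, ← sgn_smul (F := F), ← sgn_smul (F := F)] at hb
  rw [mul_comm (y r.1 r.2)]
  simp only [eq_comm (a := r.2)]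
  rw [smul_comm, smul_comm (sgn F a b) (_ * _), ← smul_sub, ← smul_sub, hb]

/-- Polarization would need division by 2. Instead, unordered pairs of distinct matrix units
contribute anticommutators, and diagonal terms contribute squares of odd units, which vanish. -/
theorem glLin_sq {e : Idx m n → Idx m n → A} (he : IsGl par e) {x : Gl m n F}
    (hx : IsHomog 1 x) : glLin F e x * glLin F e x = glLin F e (x * x) := by
  rw [glLin_mul, glLin_mul_glLin, ← sub_eq_zero]
  simp only [← Finset.sum_sub_distrib]
  rw [← Finset.sum_product']
  have diag : ∀ p : Idx m n × Idx m n, (x p.1 p.2 * x p.1 p.2) • (e p.1 p.2 * e p.1 p.2) -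
      (x p.1 p.2 * x p.1 p.2) • (if p.2 = p.1 then e p.1 p.2 else 0) = 0 := by
    intro p
    by_cases h1 : x p.1 p.2 = 0
    · simp [h1]
    have hp := hx _ _ h1
    have hne : p.2 ≠ p.1 := by
      intro h
      rw [h] at hp
      exact absurd hp (by generalize par p.1 = a; revert a; decide)
    rw [he.sq _ _ hp, if_neg hne, sub_self]
  refine Finset.sum_involution (fun s _ => (s.2, s.1)) ?_ ?_ ?_ ?_
  · rintro ⟨p, r⟩ -
    simp only
    by_cases h1 : x p.1 p.2 = 0
    · simp [h1]
    by_cases h2 : x r.1 r.2 = 0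
    · simp [h2]
    have hb := he.bracket p.1 p.2 r.1 r.2
    rw [hx _ _ h1, hx _ _ h2, sc, ksgn_one_one, neg_smul, neg_smul, one_smul, one_smul,
      sub_neg_eq_add, sub_neg_eq_add] at hb
    rw [mul_comm (x r.1 r.2), ← smul_sub, ← smul_sub, ← smul_add]
    simp only [eq_comm (a := r.2)]
    rw [sub_add_sub_comm, hb, sub_self, smul_zero]
  · rintro ⟨p, r⟩ - hne heq
    simp only [Prod.mk.injEq] at heq
    obtain ⟨rfl, -⟩ := heq
    exact hne (diag _)
  · intros; simp
  · intros; rfl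

/-- A family of elements that satisfies the relations of the matrix units defines a homomorphism
from the enveloping superalgebra. -/
noncomputable def glHom {e : Idx m n → Idx m n → A} (he : IsGl par e) : U (g m n F) →ₐ[F] A :=
  lift (g m n F) (glLin F e ∘ₗ (g m n F).carrier.subtype)
    (fun _ _ _ _ _ hx hy hz => by
      simp only [LinearMap.comp_apply, Submodule.subtype_apply, hz]
      exact glLin_bracket he hx hy)
    (fun _ _ hx hz => by
      simp only [LinearMap.comp_apply, Submodule.subtype_apply, hz]
      exact glLin_sq he hx)

theorem glHom_E {e : Idx m n → Idx m n → A} (he : IsGl par e) (i j : Idx m n) :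
    glHom (F := F) he (E i j) = e i j := by
  rw [glHom, E, lift_ι]
  exact glLin_single e i j

end Lift

/-! ### Commutativity of `U(H)` -/

theorem H_isHomog (x : (H m n F).carrier) : IsHomog 0 (x : Gl m n F) := by
  intro i j h
  obtain rfl : i = j := x.2 i j h
  generalize par i = a; revert a; decide

theorem H_comm (x y : (H m n F).carrier) : (x : Gl m n F) * y = (y : Gl m n F) * x := by
  have hd : ∀ z : (H m n F).carrier, (z : Gl m n F) = Matrix.diagonal fun i => z.1 i i := by
    intro z
    ext i j
    by_cases h : i = j
    · subst h; simp
    · rw [Matrix.diagonal_apply_ne _ h]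
      by_contra h0
      exact h (z.2 i j h0)
  rw [hd x, hd y, Matrix.diagonal_mul_diagonal, Matrix.diagonal_mul_diagonal]
  simp only [mul_comm]

theorem U_H_comm (a b : U (H m n F)) : Commute a b := by
  induction a using U_induction with
  | algebraMap c => exact Algebra.commutes c b
  | mul a a' ha ha' => exact ha.mul_left ha'
  | add a a' ha ha' => exact ha.add_left ha'
  | ι x =>
    induction b using U_induction with
    | algebraMap c => exact (Algebra.commutes c _).symm
    | mul a a' ha ha' => exact ha.mul_right ha'
    | add a a' ha ha' => exact ha.add_right ha'
    | ι y =>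
      have := ι_bracket (H m n F) 0 0 x y 0 (H_isHomog x) (H_isHomog y)
        (by simp [sbracket, sgn, H_comm x y])
      simpa [sgn, sub_eq_zero, Commute, SemiconjBy] using this

/-- `U(H)` is commutative. -/
noncomputable abbrev commRingUH (m n : ℕ) (F : Type*) [Field F] : CommRing (U (H m n F)) :=
  { instRingU (H m n F) with mul_comm := U_H_comm }

theorem ι_H_eq_sum (x : (H m n F).carrier) :
    ι (H m n F) x = ∑ i, x.1 i i • ι (H m n F) (hBasis i) := by
  have hx : x = ∑ i, x.1 i i • (hBasis i : (H m n F).carrier) := by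
    apply Subtype.ext
    simp only [AddSubmonoidClass.coe_finsetSum, Submodule.coe_smul, hBasis, Matrix.smul_single,
      smul_eq_mul, mul_one]
    ext i j
    rw [Matrix.sum_apply]
    by_cases h : i = j
    · subst h
      rw [Finset.sum_eq_single i] <;> simp +contextual
    · rw [Finset.sum_eq_zero]
      · by_contra h0
        exact h (x.2 i j h0)
      · intro k _
        rw [Matrix.single_apply_of_ne]
        rintro ⟨rfl, rfl⟩
        exact h rfl
  conv_lhs => rw [hx]
  simp only [map_sum, map_smul]

theorem toUg_hBasis (i : Idx m n) : toUg (H m n F) (ι (H m n F) (hBasis i)) = E i i :=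
  toUg_ι _ _

/-! ### Spanning in the triangular decomposition -/

theorem InI_trichotomy (i j : Idx m n) : InI i j ∨ i = j ∨ InI j i := by
  rcases i with i | i <;> rcases j with j | j <;> simp [InI, InI0, InI1]
  · exact lt_trichotomy i j
  · exact lt_trichotomy i j

theorem exists_toUg_Npos {i j : Idx m n} (h : InI i j) :
    ∃ u, toUg (Npos m n F) u = E i j :=
  ⟨ι _ ⟨Matrix.single i j 1, fun a b hab => by
    by_contra hne
    refine hab (Matrix.single_apply_of_ne _ _ _ _ _ ?_)
    rintro ⟨rfl, rfl⟩
    exact hne h⟩, toUg_ι _ _⟩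

theorem exists_toUg_Nneg {i j : Idx m n} (h : InI j i) :
    ∃ u, toUg (Nneg m n F) u = E i j :=
  ⟨ι _ ⟨Matrix.single i j 1, fun a b hab => by
    by_contra hne
    refine hab (Matrix.single_apply_of_ne _ _ _ _ _ ?_)
    rintro ⟨rfl, rfl⟩
    exact hne h⟩, toUg_ι _ _⟩

theorem triMul_tmul (a : U (Nneg m n F)) (b : U (H m n F)) (c : U (Npos m n F)) :
    triMul m n F ((a ⊗ₜ b) ⊗ₜ c) =
      toUg (Nneg m n F) a * toUg (H m n F) b * toUg (Npos m n F) c := by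
  simp [triMul]

theorem tmul_mem_range_triMul (a : U (Nneg m n F)) (b : U (H m n F)) (c : U (Npos m n F)) :
    toUg (Nneg m n F) a * (toUg (H m n F) b * toUg (Npos m n F) c) ∈
      LinearMap.range (triMul m n F) :=
  ⟨(a ⊗ₜ b) ⊗ₜ c, by rw [triMul_tmul, mul_assoc]⟩

theorem range_triMul_induction {C : U (g m n F) → Prop}
    (tmul : ∀ a b c, C (toUg (Nneg m n F) a * (toUg (H m n F) b * toUg (Npos m n F) c)))
    (zero : C 0) (add : ∀ x y, C x → C y → C (x + y)) {s : U (g m n F)}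
    (hs : s ∈ LinearMap.range (triMul m n F)) : C s := by
  obtain ⟨t, rfl⟩ := hs
  induction t using TensorProduct.induction_on with
  | zero => simpa using zero
  | add x y hx hy => simpa using add _ _ hx hy
  | tmul x c =>
    induction x using TensorProduct.induction_on with
    | zero => simpa using zero
    | add x y hx hy => simpa [TensorProduct.add_tmul] using add _ _ hx hy
    | tmul a b => simpa [triMul_tmul, mul_assoc] using tmul a b c

theorem toUg_Nneg_mul_mem (a : U (Nneg m n F)) {s : U (g m n F)}
    (hs : s ∈ LinearMap.range (triMul m n F)) :
    toUg (Nneg m n F) a * s ∈ LinearMap.range (triMul m n F) := by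
  refine range_triMul_induction (C := fun s => toUg (Nneg m n F) a * s ∈ _) ?_ ?_ ?_ hs
  · intro a' b c
    rw [← mul_assoc, ← map_mul]
    exact tmul_mem_range_triMul _ _ _
  · simp
  · intro x y hx hy
    rw [mul_add]
    exact add_mem hx hy

/-- `e_ij` is a weight vector, so it passes `x ∈ H` at the cost of adding the scalar `x_jj - x_ii`.
-/
theorem E_mul_toUg_H (i j : Idx m n) (b : U (H m n F)) :
    ∃ b', (E i j : U (g m n F)) * toUg (H m n F) b = toUg (H m n F) b' * E i j := by
  induction b using U_induction with
  | algebraMap c => exact ⟨algebraMap F _ c, by simpa using (Algebra.commutes c _).symm⟩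
  | mul a b ha hb =>
    obtain ⟨a', ha⟩ := ha
    obtain ⟨b', hb⟩ := hb
    exact ⟨a' * b', by rw [map_mul, map_mul, ← mul_assoc, ha, mul_assoc, hb, mul_assoc]⟩
  | add a b ha hb =>
    obtain ⟨a', ha⟩ := ha
    obtain ⟨b', hb⟩ := hb
    exact ⟨a' + b', by rw [map_add, map_add, mul_add, add_mul, ha, hb]⟩
  | ι x =>
    have key : ∀ k, (E i j : U (g m n F)) * E k k =
        E k k * E i j + ((if j = k then E i j else 0) - (if i = k then E i j else 0)) := by
      intro k
      have h0 : par k + par k = 0 := by generalize par k = a; revert a; decide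
      have := mul_eq_of_sc (E_bracket (F := F) i j k k)
      rw [h0, ksgn_zero_right, one_smul, one_smul] at this
      rw [this]
      by_cases h1 : j = k <;> by_cases h2 : i = k <;> simp [h1, h2]
    refine ⟨ι _ x + algebraMap F _ (x.1 j j - x.1 i i), ?_⟩
    rw [map_add, ι_H_eq_sum]
    simp only [map_sum, map_smul, toUg_hBasis, Finset.mul_sum, mul_smul_comm, key,
      smul_add, Finset.sum_add_distrib, add_mul, Finset.sum_mul, smul_mul_assoc, AlgHom.commutes]
    rw [← Algebra.smul_def]
    congr 1
    simp [smul_sub, Finset.sum_sub_distrib, sub_smul]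

theorem E_mul_borel_mem (i j : Idx m n) (b : U (H m n F)) (c : U (Npos m n F)) :
    (E i j : U (g m n F)) * (toUg (H m n F) b * toUg (Npos m n F) c) ∈
      LinearMap.range (triMul m n F) := by
  rcases InI_trichotomy i j with h | rfl | h
  · obtain ⟨u, hu⟩ := exists_toUg_Npos (F := F) h
    obtain ⟨b', hb⟩ := E_mul_toUg_H i j b
    have := tmul_mem_range_triMul 1 b' (u * c)
    rwa [map_one, one_mul, map_mul, hu, ← mul_assoc, ← hb, mul_assoc] at this
  · have := tmul_mem_range_triMul 1 (ι _ (hBasis i) * b) c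
    rwa [map_one, one_mul, map_mul, toUg_hBasis, mul_assoc] at this
  · obtain ⟨u, hu⟩ := exists_toUg_Nneg (F := F) h
    rw [← hu]
    exact tmul_mem_range_triMul u b c

/-- Induction on the word in `N⁻`. Passing `e_ij` through its first letter leaves that letter in
front of a shorter instance, plus bracket terms `e_il`, `e_kj` on the shorter word. These can be
arbitrary matrix units, so the induction must run over all `i`, `j` at once. -/
theorem E_mul_mem (a : U (Nneg m n F)) (b : U (H m n F)) (c : U (Npos m n F)) (i j : Idx m n) :
    (E i j : U (g m n F)) * (toUg (Nneg m n F) a * (toUg (H m n F) b * toUg (Npos m n F) c)) ∈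
      LinearMap.range (triMul m n F) := by
  induction a using U_induction_left generalizing i j with
  | one => simpa using E_mul_borel_mem i j b c
  | smul k a ih =>
    rw [map_smul, smul_mul_assoc, mul_smul_comm]
    exact Submodule.smul_mem _ _ (ih i j)
  | add a a' ih ih' =>
    rw [map_add, add_mul, mul_add]
    exact add_mem (ih i j) (ih' i j)
  | ι_mul x a ih =>
    rw [map_mul, mul_assoc, toUg_ι_eq_sum]
    simp only [Finset.sum_mul, Finset.mul_sum, smul_mul_assoc, mul_smul_comm]
    refine sum_mem fun k _ => sum_mem fun l _ => ?_
    by_cases hx : x.1 k l = 0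
    · simp [hx]
    obtain ⟨u, hu⟩ := exists_toUg_Nneg (F := F) (x.2 k l hx)
    refine Submodule.smul_mem _ _ ?_
    rw [← mul_assoc, mul_eq_of_sc (E_bracket (F := F) i j k l), add_mul, sub_mul, smul_mul_assoc,
      smul_mul_assoc, mul_assoc]
    refine add_mem (zsmul_mem ?_ _) (sub_mem ?_ (zsmul_mem ?_ _))
    · conv in E k l => rw [← hu]
      exact toUg_Nneg_mul_mem u (ih i j)
    · split_ifs
      · exact ih i l
      · simp
    · split_ifs
      · exact ih k j
      · simp

/-- The spanning half of the triangular decomposition. -/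
theorem triMul_surjective (m n : ℕ) (F : Type*) [Field F] :
    Function.Surjective (triMul m n F) := by
  rw [← LinearMap.range_eq_top, eq_top_iff]
  rintro u -
  suffices h : ∀ s ∈ LinearMap.range (triMul m n F), u * s ∈ LinearMap.range (triMul m n F) by
    have := h 1 ⟨(1 ⊗ₜ 1) ⊗ₜ 1, by simp [triMul_tmul]⟩
    rwa [mul_one] at this
  induction u using U_induction with
  | algebraMap c =>
    intro s hs
    rw [← Algebra.smul_def]
    exact Submodule.smul_mem _ _ hs
  | mul a b ha hb => intro s hs; rw [mul_assoc]; exact ha _ (hb _ hs)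
  | add a b ha hb => intro s hs; rw [add_mul]; exact add_mem (ha _ hs) (hb _ hs)
  | ι x =>
    intro s hs
    rw [ι_g_eq_sum]
    simp only [Finset.sum_mul, smul_mul_assoc]
    refine sum_mem fun i _ => sum_mem fun j _ => Submodule.smul_mem _ _ ?_
    refine range_triMul_induction (C := fun s => E i j * s ∈ _) ?_ ?_ ?_ hs
    · exact fun a b c => E_mul_mem a b c i j
    · simp
    · intro x y hx hy
      rw [mul_add]
      exact add_mem hx hy

/-! ### Odd reflections and the action of `e_{I₁} f_{I₁}` on a highest weight vector -/

section HighestWeight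

variable {m n : ℕ} {R : Type*} [CommRing R] {M : Type*} [AddCommGroup M] [Module R M]

/-- A highest weight vector `v` of weight `h`. -/
structure IsHighestWeight (e : Idx m n → Idx m n → Module.End R M) (h : Idx m n → R) (v : M) :
    Prop where
  gl : IsGl par e
  up : ∀ i j, InI i j → e i j v = 0
  diag : ∀ i, e i i v = h i • v

/-- The product of the `f_p v` over a list of odd roots. -/
def oddWord (e : Idx m n → Idx m n → Module.End R M) (L : List (Fin m × Fin n)) :
    Module.End R M :=
  (L.map fun p => e (Sum.inr p.2) (Sum.inl p.1)).prod

/-- The order on odd roots. -/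
def Prec {m n : ℕ} (p r : Fin m × Fin n) : Prop := r.2 < p.2 ∨ p.2 = r.2 ∧ p.1 < r.1

theorem Prec.asymm {p r : Fin m × Fin n} (h : Prec p r) : ¬ Prec r p := by
  rintro (h' | ⟨h', h''⟩) <;> rcases h with h | ⟨h, h1⟩ <;> order

theorem Prec.trichotomy (p r : Fin m × Fin n) : Prec p r ∨ p = r ∨ Prec r p := by
  obtain ⟨a, b⟩ := p
  obtain ⟨c, d⟩ := r
  simp only [Prec, Prod.mk.injEq]
  rcases lt_trichotomy b d with h | h | h
  · exact Or.inr (Or.inr (Or.inl h))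
  · rcases lt_trichotomy a c with h' | h' | h'
    · exact Or.inl (Or.inr ⟨h, h'⟩)
    · exact Or.inr (Or.inl ⟨h', h⟩)
    · exact Or.inr (Or.inr (Or.inr ⟨h.symm, h'⟩))
  · exact Or.inl (Or.inl h)

/-- A final segment of the list of odd roots. -/
structure IsFinal (L : List (Fin m × Fin n)) : Prop where
  pairwise : L.Pairwise Prec
  closed : ∀ p ∈ L, ∀ r, Prec p r → r ∈ L

theorem IsFinal.tail {p : Fin m × Fin n} {L : List (Fin m × Fin n)} (h : IsFinal (p :: L)) :
    IsFinal L where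
  pairwise := (List.pairwise_cons.1 h.pairwise).2
  closed r hr s hs := by
    have := h.closed r (List.mem_cons_of_mem _ hr) s hs
    rcases List.mem_cons.1 this with rfl | h'
    · exact absurd hs ((List.pairwise_cons.1 h.pairwise).1 r hr).asymm
    · exact h'

/-- The rightmost factors of `f_{I₁}` act first, so partial products belong to final segments;
membership in the tail becomes a comparison with its predecessor. -/
theorem IsFinal.mem_tail_iff {p : Fin m × Fin n} {L : List (Fin m × Fin n)}
    (h : IsFinal (p :: L)) (r : Fin m × Fin n) : r ∈ L ↔ Prec p r := by
  constructor
  · exact (List.pairwise_cons.1 h.pairwise).1 r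
  · intro hr
    have := h.closed p List.mem_cons_self r hr
    rcases List.mem_cons.1 this with rfl | h'
    · exact absurd hr hr.asymm
    · exact h'

theorem IsFinal.nodup {L : List (Fin m × Fin n)} (h : IsFinal L) : L.Nodup :=
  h.pairwise.imp fun {a b} hab => by
    rintro rfl
    exact hab.asymm hab

theorem isFinal_I1List (m n : ℕ) : IsFinal (I1List m n) :=
  ⟨I1List_pairwise m n, fun _ _ r _ => mem_I1List r⟩

theorem par_inl_inr (i : Fin m) (j : Fin n) :
    (par (Sum.inl i : Idx m n) + par (Sum.inr j : Idx m n)) = 1 := by simp [par]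

theorem par_inr_inl (i : Fin m) (j : Fin n) :
    (par (Sum.inr j : Idx m n) + par (Sum.inl i : Idx m n)) = 1 := by simp [par]

variable {e : Idx m n → Idx m n → Module.End R M} {h : Idx m n → R} {v : M}

/-- Odd reflections: applying the `f_p` in the given order yields highest weight vectors for a
chain of Borel subalgebras. -/
theorem IsHighestWeight.odd_reflection (hv : IsHighestWeight e h v) {L : List (Fin m × Fin n)}
    (hL : IsFinal L) :
    (∀ a b, InI0 a b → e a b (oddWord e L v) = 0) ∧
    (∀ p ∉ L, e (Sum.inl p.1) (Sum.inr p.2) (oddWord e L v) = 0) ∧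
    (∀ p ∈ L, e (Sum.inr p.2) (Sum.inl p.1) (oddWord e L v) = 0) := by
  -- The three clauses describe the Borel subalgebra reflected in the roots of `L`. They go through
  -- the induction only together, since bracket terms for one clause are killed by another.
  induction L with
  | nil =>
    refine ⟨fun a b hab => ?_, fun p _ => ?_, fun p hp => absurd hp List.not_mem_nil⟩
    · exact hv.up _ _ (Or.inl hab)
    · exact hv.up _ _ (Or.inr trivial)
  | cons p L ih =>
    obtain ⟨h1, h2, h3⟩ := ih hL.tail
    obtain ⟨i, j⟩ := p
    set w := oddWord e L v with hw
    have hcons : oddWord e ((i, j) :: L) v = e (Sum.inr j) (Sum.inl i) w := by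
      simp [oddWord, hw]
    have hmul : ∀ (a b : Idx m n), e a b (e (Sum.inr j) (Sum.inl i) w) =
        ksgn (par a + par b) 1 • e (Sum.inr j) (Sum.inl i) (e a b w) +
          ((if b = Sum.inr j then e a (Sum.inl i) w else 0) -
            ksgn (par a + par b) 1 • (if a = Sum.inl i then e (Sum.inr j) b w else 0)) := by
      intro a b
      have := mul_eq_of_sc (hv.gl.bracket a b (Sum.inr j) (Sum.inl i))
      rw [par_inr_inl] at this
      have := LinearMap.congr_fun this w
      rw [Module.End.mul_apply] at this
      rw [this]
      simp only [LinearMap.add_apply, LinearMap.sub_apply, LinearMap.smul_apply,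
        Module.End.mul_apply]
      split_ifs <;> simp
    rw [hcons]
    refine ⟨fun a b hab => ?_, fun r hr => ?_, fun r hr => ?_⟩
    · rw [hmul, h1 a b hab, map_zero, smul_zero, zero_add]
      -- The bracket terms are `f` at `(i, a)` with `a < j`, or at `(b, j)` with `b > i`. Both
      -- places come after `(i, j)`, so the third clause for `L` applies.
      have e1 : (if b = Sum.inr j then e a (Sum.inl i) w else 0) = 0 := by
        split_ifs with hb
        · subst hb
          rcases a with a | a
          · exact hab.elim
          · exact h3 (i, a) ((hL.mem_tail_iff _).2 (Or.inl hab))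
        · rfl
      have e2 : (if a = Sum.inl i then e (Sum.inr j) b w else 0) = 0 := by
        split_ifs with ha
        · subst ha
          rcases b with b | b
          · exact h3 (b, j) ((hL.mem_tail_iff _).2 (Or.inr ⟨rfl, hab⟩))
          · exact hab.elim
        · rfl
      rw [e1, e2, smul_zero, sub_zero]
    · obtain ⟨s, t⟩ := r
      rw [List.mem_cons, not_or] at hr
      have hprec : Prec (s, t) (i, j) := by
        rcases Prec.trichotomy (s, t) (i, j) with h' | h' | h'
        · exact h'
        · exact absurd h' hr.1
        · exact absurd ((hL.mem_tail_iff _).2 h') hr.2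
      rw [hmul, h2 _ hr.2, map_zero, smul_zero, zero_add]
      simp only [Sum.inr.injEq, Sum.inl.injEq]
      -- Since `(s, t)` precedes `(i, j)`, a shared column gives `s < i` and a shared row gives `j <
      -- t`; the bracket is then an even positive root vector, which kills `w`.
      have e1 : (if t = j then e (Sum.inl s) (Sum.inl i) w else 0) = 0 := by
        split_ifs with ht
        · refine h1 _ _ ?_
          rcases hprec with h' | h'
          · exact absurd h' (by simp [ht])
          · exact h'.2
        · rfl
      have e2 : (if s = i then e (Sum.inr j) (Sum.inr t) w else 0) = 0 := by
        split_ifs with hs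
        · refine h1 _ _ ?_
          rcases hprec with h' | h'
          · exact h'
          · exact absurd h'.2 (by simp [hs])
        · rfl
      rw [e1, e2, smul_zero, sub_zero]
    · rcases List.mem_cons.1 hr with rfl | hr
      · rw [← Module.End.mul_apply, hv.gl.sq _ _ (par_inr_inl i j), LinearMap.zero_apply]
      · rw [hmul, h3 r hr]
        simp

/-- The shift of the weight caused by the odd roots in the list `L`. -/
def shift (p : Fin m × Fin n) (L : List (Fin m × Fin n)) : ℤ :=
  (L.countP fun r => r.2 = p.2) - (L.countP fun r => r.1 = p.1)

/-- Each `f` has weight minus its odd root: it raises `e_jj` by one in its column and lowers `e_ii`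
by one in its row. Only the sum matters, because `[e_p, f_p] = e_ii + e_jj`. -/
theorem IsHighestWeight.weight_oddWord (hv : IsHighestWeight e h v) (p : Fin m × Fin n)
    (L : List (Fin m × Fin n)) :
    (e (Sum.inl p.1) (Sum.inl p.1) + e (Sum.inr p.2) (Sum.inr p.2)) (oddWord e L v) =
      (h (Sum.inl p.1) + h (Sum.inr p.2) + (shift p L : R)) • oddWord e L v := by
  induction L with
  | nil => simp [oddWord, shift, hv.diag, add_smul]
  | cons r L ih =>
    set w := oddWord e L v with hw
    have hcons : oddWord e (r :: L) v = e (Sum.inr r.2) (Sum.inl r.1) w := by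
      simp [oddWord, hw]
    have hpar : ∀ a : Idx m n, par a + par a = 0 := fun a => by
      generalize par a = b; revert b; decide
    have hmul : ∀ a, e a a (e (Sum.inr r.2) (Sum.inl r.1) w) =
        e (Sum.inr r.2) (Sum.inl r.1) (e a a w) +
          ((if a = Sum.inr r.2 then e (Sum.inr r.2) (Sum.inl r.1) w else 0) -
            (if a = Sum.inl r.1 then e (Sum.inr r.2) (Sum.inl r.1) w else 0)) := by
      intro a
      have := mul_eq_of_sc (hv.gl.bracket a a (Sum.inr r.2) (Sum.inl r.1))
      rw [hpar, ksgn_zero_left, one_smul, one_smul] at this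
      have := LinearMap.congr_fun this w
      rw [Module.End.mul_apply] at this
      rw [this]
      simp only [LinearMap.add_apply, LinearMap.sub_apply, Module.End.mul_apply]
      congr 2
      · split_ifs with h'
        · rw [h']
        · rfl
      · split_ifs with h'
        · rw [h']
        · rfl
    rw [hcons, LinearMap.add_apply, hmul, hmul]
    have hsum : e (Sum.inr r.2) (Sum.inl r.1) (e (Sum.inl p.1) (Sum.inl p.1) w) +
        e (Sum.inr r.2) (Sum.inl r.1) (e (Sum.inr p.2) (Sum.inr p.2) w) =
        (h (Sum.inl p.1) + h (Sum.inr p.2) + (shift p L : R)) •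
          e (Sum.inr r.2) (Sum.inl r.1) w := by
      rw [← map_add, ← LinearMap.add_apply, ih, map_smul]
    have hshift : (shift p (r :: L) : R) =
        shift p L + ((if p.2 = r.2 then 1 else 0) - (if p.1 = r.1 then 1 else 0)) := by
      simp only [shift, List.countP_cons, decide_eq_true_eq, eq_comm (a := p.1),
        eq_comm (a := p.2)]
      push_cast
      ring
    rw [hshift]
    simp only [Sum.inl.injEq, Sum.inr.injEq, reduceCtorEq, if_false]
    rw [zero_sub, sub_zero, ← add_assoc (_ + _) (shift p L : R), add_smul _ (_ - _), ← hsum]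
    split_ifs <;> simp <;> abel

/-- The value of `e_L f_L` on a highest weight vector. -/
def oddPoly {R : Type*} [Ring R] (h : Idx m n → R) : List (Fin m × Fin n) → R
  | [] => 1
  | p :: L => (h (Sum.inl p.1) + h (Sum.inr p.2) + (shift p L : R)) * oddPoly h L

/-- The reversed order puts `e_p` next to `f_p`. As `p ∉ L`, `e_p` kills the word of `L`, so `e_p
f_p` acts there as the anticommutator, a scalar, and the remaining product is the one for `L`. -/
theorem IsHighestWeight.oddPoly_smul (hv : IsHighestWeight e h v) {L : List (Fin m × Fin n)}
    (hL : IsFinal L) :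
    (L.reverse.map fun p => e (Sum.inl p.1) (Sum.inr p.2)).prod (oddWord e L v) =
      oddPoly h L • v := by
  induction L with
  | nil => simp [oddWord, oddPoly]
  | cons p L ih =>
    have hcons : oddWord e (p :: L) v = e (Sum.inr p.2) (Sum.inl p.1) (oddWord e L v) := by
      simp [oddWord]
    have hp : p ∉ L := fun hp => ((hL.mem_tail_iff p).1 hp).asymm ((hL.mem_tail_iff p).1 hp)
    have hstep : e (Sum.inl p.1) (Sum.inr p.2) (oddWord e (p :: L) v) =
        (h (Sum.inl p.1) + h (Sum.inr p.2) + (shift p L : R)) • oddWord e L v := by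
      rw [← hv.weight_oddWord]
      have := mul_eq_of_sc (hv.gl.bracket (Sum.inl p.1) (Sum.inr p.2) (Sum.inr p.2) (Sum.inl p.1))
      rw [par_inl_inr, par_inr_inl, ksgn_one_one, if_pos rfl, if_pos rfl, neg_smul, neg_smul,
        one_smul, one_smul, sub_neg_eq_add] at this
      have := LinearMap.congr_fun this (oddWord e L v)
      rw [Module.End.mul_apply] at this
      rw [hcons, this]
      simp [(hv.odd_reflection hL.tail).2.1 p hp]
    rw [List.reverse_cons, List.map_append, List.prod_append, Module.End.mul_apply]
    simp only [List.map_cons, List.map_nil, List.prod_singleton]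
    rw [hstep, map_smul, ih hL.tail, smul_smul, oddPoly]

end HighestWeight

/-! ### The Harish-Chandra projection -/

variable {m n : ℕ} {F : Type*} [Field F]

/-- In the linear order of `Fin (m + n)`, `N⁺` is strictly upper triangular, so
`exists_highest_weight` applies. -/
theorem InI.lt {i j : Idx m n} (h : InI i j) : finSumFinEquiv i < finSumFinEquiv j := by
  rcases i with i | i <;> rcases j with j | j <;> simp only [InI, InI0, InI1, or_false, or_true] at h
  · rwa [finSumFinEquiv_apply_left, finSumFinEquiv_apply_left, Fin.lt_def, Fin.val_castAdd,
      Fin.val_castAdd, ← Fin.lt_def]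
  · rw [finSumFinEquiv_apply_left, finSumFinEquiv_apply_right, Fin.lt_def, Fin.val_castAdd,
      Fin.val_natAdd]
    omega
  · rw [finSumFinEquiv_apply_right, finSumFinEquiv_apply_right, Fin.lt_def, Fin.val_natAdd,
      Fin.val_natAdd]
    exact Nat.add_lt_add_left h m

/-- The Harish-Chandra projection: the component in `U(H)`, specialized along `χ`, factors through
`U(𝔤)`. -/
theorem exists_projection {R : Type u} [CommRing R] [Algebra F R] (χ : U (H m n F) →ₐ[F] R) :
    ∃ π : U (g m n F) → R, (∀ t, π (triMul m n F t) = χ (hComp m n F t)) ∧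
      π (eI1 m n F * fI1 m n F) = oddPoly (fun i => χ (ι _ (hBasis i))) (I1List m n) := by
  set h : Idx m n → R := fun i => χ (ι _ (hBasis i)) with hh
  obtain ⟨M, _, _, Γ, e', v, φ, -, -, hgl', hup, hdiag, hlow, hφv⟩ :=
    exists_highest_weight (m + n) (fun i => (par (finSumFinEquiv.symm i) : ZMod 2))
      (fun i => h (finSumFinEquiv.symm i))
  set e : Idx m n → Idx m n → Module.End R M :=
    fun i j => e' (finSumFinEquiv i) (finSumFinEquiv j) with he
  have hv : IsHighestWeight e h v :=
    { gl := by simpa using hgl'.comp (finSumFinEquiv (m := m) (n := n)).injective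
      up := fun i j hij => hup _ _ hij.lt
      diag := fun i => by simpa using hdiag (finSumFinEquiv i) }
  have hlow' : ∀ i j, InI j i → ∀ x, φ (e i j x) = 0 := fun i j hij x => hlow _ _ hij.lt x
  -- `M` carries only an `R`-module structure; restricting scalars makes `Module.End R M` an
  -- `F`-algebra, the target of `glHom`.
  let _ : Module F M := Module.compHom M (algebraMap F R)
  have : IsScalarTower F R M := ⟨fun a b x => by
    rw [Algebra.smul_def, mul_smul]; rfl⟩
  set ρ : U (g m n F) →ₐ[F] Module.End R M := glHom hv.gl with hρ
  have hρE : ∀ i j, ρ (E i j) = e i j := glHom_E hv.gl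
  have hmapF : ∀ (c : F) (x : M), algebraMap F (Module.End R M) c x = algebraMap F R c • x :=
    fun c x => (algebraMap_smul R c x).symm
  have hsmul : ∀ (c : F) (T : Module.End R M) (x : M), (c • T) x = algebraMap F R c • T x :=
    fun c T x => (algebraMap_smul R c (T x)).symm
  have hpos : ∀ u, ρ (toUg (Npos m n F) u) v = algebraMap F R (counit _ u) • v := by
    intro u
    induction u using U_induction with
    | algebraMap c => simp only [AlgHom.commutes, hmapF]; rfl
    | mul a b ha hb =>
      rw [map_mul, map_mul, Module.End.mul_apply, hb, map_smul, ha, smul_smul, map_mul, map_mul,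
        mul_comm]
    | add a b ha hb => rw [map_add, map_add, LinearMap.add_apply, ha, hb, map_add, map_add, add_smul]
    | ι x =>
      rw [counit_ι, map_zero, zero_smul, toUg_ι_eq_sum]
      simp only [map_sum, map_smul, LinearMap.sum_apply, hsmul, hρE]
      refine Finset.sum_eq_zero fun i _ => Finset.sum_eq_zero fun j _ => ?_
      by_cases hx : x.1 i j = 0
      · simp [hx]
      · rw [hv.up i j (x.2 i j hx), smul_zero]
  have hzero : ∀ u, ρ (toUg (H m n F) u) v = χ u • v := by
    intro u
    induction u using U_induction with
    | algebraMap c => simp only [AlgHom.commutes, hmapF]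
    | mul a b ha hb =>
      rw [map_mul, map_mul, Module.End.mul_apply, hb, map_smul, ha, smul_smul, map_mul, mul_comm]
    | add a b ha hb => rw [map_add, map_add, LinearMap.add_apply, ha, hb, map_add, add_smul]
    | ι x =>
      rw [ι_H_eq_sum]
      simp only [map_sum, map_smul, LinearMap.sum_apply, hsmul, toUg_hBasis, hρE, hv.diag,
        Finset.sum_smul]
      refine Finset.sum_congr rfl fun i _ => ?_
      rw [Algebra.smul_def, mul_smul]
  have hneg : ∀ u x, φ (ρ (toUg (Nneg m n F) u) x) = algebraMap F R (counit _ u) * φ x := by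
    intro u
    induction u using U_induction with
    | algebraMap c => intro x; simp only [AlgHom.commutes, hmapF, map_smul, smul_eq_mul]; rfl
    | mul a b ha hb =>
      intro x
      rw [map_mul, map_mul, Module.End.mul_apply, ha, hb, map_mul, map_mul, mul_assoc]
    | add a b ha hb =>
      intro x
      rw [map_add, map_add, LinearMap.add_apply, map_add, ha, hb, map_add, map_add, add_mul]
    | ι x =>
      intro y
      rw [counit_ι, map_zero, zero_mul, toUg_ι_eq_sum]
      simp only [map_sum, map_smul, LinearMap.sum_apply, hsmul, hρE]
      refine Finset.sum_eq_zero fun i _ => Finset.sum_eq_zero fun j _ => ?_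
      by_cases hx : x.1 i j = 0
      · simp [hx]
      · rw [hlow' i j (x.2 i j hx), smul_zero]
  have hπ : ∀ t, φ (ρ (triMul m n F t) v) = χ (hComp m n F t) := by
    intro t
    induction t using TensorProduct.induction_on with
    | zero => simp
    | add x y hx hy => simp only [map_add, LinearMap.add_apply, hx, hy]
    | tmul x c =>
      induction x using TensorProduct.induction_on with
      | zero => simp
      | add x y hx hy => simp only [TensorProduct.add_tmul, map_add, LinearMap.add_apply, hx, hy]
      | tmul a b =>
        rw [triMul_tmul, map_mul, map_mul, Module.End.mul_apply, Module.End.mul_apply, hpos,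
          map_smul, map_smul, map_smul, hneg, hzero, map_smul, hφv]
        simp [hComp, Algebra.smul_def, mul_comm]
  refine ⟨fun u => φ (ρ u v), hπ, ?_⟩
  · have hw : ρ (fI1 m n F) = oddWord e (I1List m n) := by
      simp only [fI1, oddWord, map_list_prod, List.map_map, Function.comp_def, hρE]
    have hw' : ρ (eI1 m n F) =
        ((I1List m n).reverse.map fun p => e (Sum.inl p.1) (Sum.inr p.2)).prod := by
      simp only [eI1, map_list_prod, List.map_map, Function.comp_def, hρE]
    simp only [map_mul, Module.End.mul_apply, hw, hw', hv.oddPoly_smul (isFinal_I1List m n),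
      map_smul, hφv, smul_eq_mul, mul_one]

/-! ### Explicit form of the scalar factors -/

variable {m n : ℕ}

/-- After `p = (i, j)` come the `(a, j)` with `a > i`, of which there are `m - 1 - i`, and, in row
`i`, the `(i, b)` with `b < j`, of which there are `j`, counting from zero. -/
theorem IsFinal.shift_eq {p : Fin m × Fin n} {L : List (Fin m × Fin n)}
    (h : IsFinal (p :: L)) : shift p L = m - 1 - p.1 - p.2 := by
  classical
  have hL : ∀ P : Fin m × Fin n → Prop, ∀ [DecidablePred P],
      L.countP (fun r => P r) = (Finset.univ.filter fun r => Prec p r ∧ P r).card := by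
    intro P _
    rw [List.countP_eq_length_filter, ← List.toFinset_card_of_nodup (h.tail.nodup.filter _)]
    refine congrArg Finset.card ?_
    ext r
    simp [h.mem_tail_iff]
  have h1 : L.countP (fun r => r.2 = p.2) = m - 1 - p.1 := by
    rw [hL fun r => r.2 = p.2, ← Fin.card_Ioi, ← Finset.card_image_of_injective (Finset.Ioi p.1)
      (f := fun i => (i, p.2)) fun a b hab => (Prod.ext_iff.1 hab).1]
    refine congrArg Finset.card ?_
    ext ⟨a, b⟩
    rw [Finset.mem_filter]
    simp only [Prec, Finset.mem_univ, true_and, Finset.mem_image,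
      Finset.mem_Ioi, Prod.mk.injEq]
    constructor
    · rintro ⟨h' | h', rfl⟩
      · exact absurd h' (lt_irrefl _)
      · exact ⟨a, h'.2, rfl, rfl⟩
    · rintro ⟨a', h', rfl, rfl⟩
      exact ⟨Or.inr ⟨rfl, h'⟩, rfl⟩
  have h2 : L.countP (fun r => r.1 = p.1) = p.2 := by
    rw [hL fun r => r.1 = p.1, ← Fin.card_Iio p.2, ← Finset.card_image_of_injective (Finset.Iio p.2)
      (f := fun j => (p.1, j)) fun a b hab => (Prod.ext_iff.1 hab).2]
    refine congrArg Finset.card ?_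
    ext ⟨a, b⟩
    rw [Finset.mem_filter]
    simp only [Prec, Finset.mem_univ, true_and, Finset.mem_image,
      Finset.mem_Iio, Prod.mk.injEq]
    constructor
    · rintro ⟨h' | h', rfl⟩
      · exact ⟨b, h', rfl, rfl⟩
      · exact absurd h'.2 (lt_irrefl _)
    · rintro ⟨b', h', rfl, rfl⟩
      exact ⟨Or.inl h', rfl⟩
  have := p.1.isLt
  rw [shift, h1, h2]
  omega

/-- The source need only be a ring, so this applies to `U(H)` with its given ring structure. -/
theorem map_oddPoly {R K : Type*} [Ring R] [CommRing K] (ψ : R →+* K) (h : Idx m n → R)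
    {L : List (Fin m × Fin n)} (hL : IsFinal L) :
    ψ (oddPoly h L) = (L.map fun p => ψ (h (Sum.inl p.1)) + ψ (h (Sum.inr p.2)) +
      (((m : ℤ) - 1 - p.1 - p.2 : ℤ) : K)).prod := by
  induction L with
  | nil => simp [oddPoly]
  | cons p L ih =>
    rw [oddPoly, map_mul, ih hL.tail, hL.shift_eq, List.map_cons, List.prod_cons, map_add, map_add,
      map_intCast]

theorem prod_I1List {K : Type*} [CommRing K] (f : Fin m × Fin n → K) :
    ((I1List m n).map f).prod = ∏ i, ∏ j, f (i, j) := by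
  classical
  rw [← List.prod_toFinset f (isFinal_I1List m n).nodup, ← Fintype.prod_prod_type]
  refine Finset.prod_congr ?_ fun _ _ => rfl
  ext p
  simp [mem_I1List]

/-! ### The bilinear form and `ρ` -/

section Form

variable {K : Type*} [Field K]

theorem eps_hBasis (i k : Idx m n) : eps K i (hBasis k) = if k = i then 1 else 0 := by
  rw [eps_apply]
  simp [hBasis, Matrix.single_apply]

/-- The minus sign of the form on `ε_j` cancels the one in `ε_i - ε_j`. -/
theorem form_root (lam : Hdual m n K) (i : Fin m) (j : Fin n) :
    form lam (root K (Sum.inl i) (Sum.inr j)) =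
      lam (hBasis (Sum.inl i)) + lam (hBasis (Sum.inr j)) := by
  simp [form, root, eps_hBasis]

/-- The coefficient of `ε_i` in the sum of the positive roots of `gl(k)`: `k - 1 - i` roots start at
`i` and `i` roots end there. -/
theorem sum_lt_sub {k : ℕ} (i : Fin k) :
    (∑ x : Fin k, ∑ y : Fin k, if x < y then
      ((if i = x then 1 else 0) - (if i = y then 1 else 0) : K) else 0) = k - 1 - 2 * i := by
  have h1 : (∑ x : Fin k, ∑ y : Fin k, if x < y then (if i = x then 1 else 0 : K) else 0) =
      (Finset.Ioi i).card := by
    rw [Finset.sum_eq_single i]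
    · simp [Finset.filter_lt_eq_Ioi]
    · intro b _ hb
      simp [Ne.symm hb]
    · simp
  have h2 : (∑ x : Fin k, ∑ y : Fin k, if x < y then (if i = y then 1 else 0 : K) else 0) =
      (Finset.Iio i).card := by
    rw [Finset.sum_comm, Finset.sum_eq_single i]
    · simp [Finset.filter_gt_eq_Iio]
    · intro b _ hb
      simp [Ne.symm hb]
    · simp
  have h3 : ∀ x y : Fin k, (if x < y then
      ((if i = x then 1 else 0) - (if i = y then 1 else 0) : K) else 0) =
      (if x < y then (if i = x then 1 else 0) else 0) -
      (if x < y then (if i = y then 1 else 0) else 0) := by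
    intro x y
    split_ifs <;> simp
  simp only [h3, Finset.sum_sub_distrib, h1, h2, Fin.card_Ioi, Fin.card_Iio]
  have := i.isLt
  rw [Nat.sub_sub, Nat.cast_sub (by omega)]
  push_cast
  ring

open Classical in
theorem sum_root_hBasis (P : Idx m n → Idx m n → Prop) (a : Idx m n) :
    (∑ p : Idx m n × Idx m n with P p.1 p.2, root K p.1 p.2) (hBasis a) =
      ∑ x, ∑ y, if P x y then ((if a = x then 1 else 0) - (if a = y then 1 else 0) : K) else 0 := by
  rw [Finset.sum_filter, LinearMap.sum_apply, Fintype.sum_prod_type]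
  refine Finset.sum_congr rfl fun x _ => Finset.sum_congr rfl fun y _ => ?_
  split_ifs <;> simp_all [root, eps_hBasis]

theorem rho_inl (i : Fin m) : rho m n K (hBasis (Sum.inl i)) = 1 / 2 * (m - 1 - 2 * i - n) := by
  rw [rho, rho0, rho1, LinearMap.sub_apply, LinearMap.smul_apply, LinearMap.smul_apply,
    sum_root_hBasis, sum_root_hBasis, mul_sub, ← sum_lt_sub i, smul_eq_mul, smul_eq_mul]
  congr 2
  · simp only [Fintype.sum_sum_type, InI0, if_false, Finset.sum_const_zero, add_zero,
      Sum.inl.injEq, reduceCtorEq, sub_self, ite_self]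
  · simp [Fintype.sum_sum_type, InI1]

theorem rho_inr (j : Fin n) : rho m n K (hBasis (Sum.inr j)) = 1 / 2 * (n - 1 - 2 * j + m) := by
  have h0 : rho0 m n K (hBasis (Sum.inr j)) = 1 / 2 * (n - 1 - 2 * j) := by
    rw [rho0, LinearMap.smul_apply, sum_root_hBasis, ← sum_lt_sub j, smul_eq_mul]
    congr 1
    simp only [Fintype.sum_sum_type, InI0, if_false, Finset.sum_const_zero, zero_add,
      Sum.inr.injEq, reduceCtorEq, sub_self, ite_self]
  have h1 : rho1 m n K (hBasis (Sum.inr j)) = - (1 / 2 * m) := by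
    rw [rho1, LinearMap.smul_apply, sum_root_hBasis, smul_eq_mul, ← mul_neg]
    congr 1
    simp [Fintype.sum_sum_type, InI1]
  rw [rho, LinearMap.sub_apply, h0, h1]
  ring

/-- In the sum of the two coordinates of `ρ` the terms in `n` cancel and all others double, which
absorbs the factor `1 / 2`. -/
theorem form_rho_root (h2 : (2 : K) ≠ 0) (i : Fin m) (j : Fin n) :
    form (rho m n K) (root K (Sum.inl i) (Sum.inr j)) = (((m : ℤ) - 1 - i - j : ℤ) : K) := by
  rw [form_root, rho_inl, rho_inr]
  push_cast
  field_simp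
  ring

end Form

theorem evalAt_ι {F : Type*} [Field F] (lam : Hdual m n F) (x : (H m n F).carrier) :
    evalAt lam (ι _ x) = lam x := by
  rw [evalAt, lift_ι]

end GlSuper

/-! ### The main theorem -/

theorem theorem4p2 (F : Type*) [Field F] (m n : ℕ) :
    -- the `U(H)`-component `f` of `e_{I₁} f_{I₁}` exists and is well defined
    ∃ f : GlSuper.U (GlSuper.H m n F),
      (∃ t, GlSuper.triMul m n F t = GlSuper.eI1 m n F * GlSuper.fI1 m n F) ∧
      (∀ t, GlSuper.triMul m n F t = GlSuper.eI1 m n F * GlSuper.fI1 m n F →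
        GlSuper.hComp m n F t = f) ∧
      -- if `2 ≠ 0` in `F`, then `ρ ∈ H*`, and this is the value of `f`
      ((2 : F) ≠ 0 → ∀ lam : GlSuper.Hdual m n F,
        GlSuper.evalAt lam f = ∏ i : Fin m, ∏ j : Fin n,
          GlSuper.form (lam + GlSuper.rho m n F) (GlSuper.root F (Sum.inl i) (Sum.inr j))) ∧
      -- in every characteristic: `(ρ, α)`, computed over `ℚ`, is an integer `c` for each odd
      -- positive root `α`, and `(lam + ρ, α)` is read as `(lam, α) + c`
      ∃ c : Fin m → Fin n → ℤ,
        (∀ i j, GlSuper.form (GlSuper.rho m n ℚ) (GlSuper.root ℚ (Sum.inl i) (Sum.inr j)) =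
          (c i j : ℚ)) ∧
        ∀ lam : GlSuper.Hdual m n F,
          GlSuper.evalAt lam f = ∏ i : Fin m, ∏ j : Fin n,
            (GlSuper.form lam (GlSuper.root F (Sum.inl i) (Sum.inr j)) + (c i j : F)) := by
  open GlSuper in
  have hproj : ∀ t, triMul m n F t = eI1 m n F * fI1 m n F →
      hComp m n F t = oddPoly (fun i => ι (H m n F) (hBasis i)) (I1List m n) := by
    -- The universal case: coefficients in `U(H)` itself and `χ` the identity, so the projection
    -- returns the component and not just a value of it. The commutative structure extends the given
    -- ring structure.
    let _ : CommRing (U (H m n F)) := commRingUH m n F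
    obtain ⟨π, h1, h2⟩ := exists_projection (AlgHom.id F (U (H m n F)))
    intro t ht
    rw [← ht, h1] at h2
    exact h2
  have heval : ∀ lam : GlSuper.Hdual m n F,
      GlSuper.evalAt lam (GlSuper.oddPoly (fun i => GlSuper.ι (GlSuper.H m n F) (GlSuper.hBasis i))
        (GlSuper.I1List m n)) = ∏ i : Fin m, ∏ j : Fin n,
        (GlSuper.form lam (GlSuper.root F (Sum.inl i) (Sum.inr j)) +
          (((m : ℤ) - 1 - i - j : ℤ) : F)) := by
    intro lam
    have := GlSuper.map_oddPoly (GlSuper.evalAt lam : _ →+* F)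
      (fun i => GlSuper.ι (GlSuper.H m n F) (GlSuper.hBasis i)) (GlSuper.isFinal_I1List m n)
    rw [GlSuper.prod_I1List] at this
    simpa only [RingHom.coe_coe, GlSuper.evalAt_ι, ← GlSuper.form_root] using this
  refine ⟨_, GlSuper.triMul_surjective m n F _, hproj, fun h2 lam => ?_,
    fun i j => (m : ℤ) - 1 - i - j, fun i j => GlSuper.form_rho_root two_ne_zero i j, heval⟩
  rw [heval]
  refine Finset.prod_congr rfl fun i _ => Finset.prod_congr rfl fun j _ => ?_
  rw [← GlSuper.form_rho_root h2, GlSuper.form_root, GlSuper.form_root, GlSuper.form_root]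
  simp only [LinearMap.add_apply]
  ring
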